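/- Let $T_n$ be a polynomial of degree $n\ge 1$ with complex coefficients and leading coefficient $c_n$, and let $T_n^{-1}([-1,1]):=\{z\in\mathbb{C}:T_n(z)\in[-1,1]\}$. A Jordan arc is the image of an injective continuous map $\gamma:[0,1]\to\mathbb{C}$, with endpoints $\gamma(0)$ and $\gamma(1)$; it need not be analytic. We say that a set $S\subseteq\mathbb{C}$ consists of $k$ Jordan arcs with endpoints $a_1,\dots,a_{2k}$ if $S$ is the union of $k$ Jordan arcs, any two of which have at most finitely many points in common (so they may touch or cross but do not overlap), and $a_1,\dots,a_{2k}$ is, in some order, the list of the $2k$ endpoints of these arcs (an endpoint common to several arcs being listed once for each of them). Let $\ell\ge 0$ be an integer and $a_1,\dots,a_{2\ell}\in\mathbb{C}$. Then the following are equivalent: (i) $T_n^{-1}([-1,1])$ consists of $\ell$ Jordan arcs with endpoints $a_1,\dots,a_{2\ell}$, and it does not consist of fewer than $\ell$ Jordan arcs (with whatever endpoints); (ii) $1\le\ell\le n$, the points $a_1,\dots,a_{2\ell}$ are pairwise distinct, and they are exactly the zeros of odd multiplicity of $T_n^2-1$; (iii) $1\le\ell\le n$, the points $a_1,\dots,a_{2\ell}$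 are pairwise distinct, and there is a polynomial $U_{n-\ell}$ of degree $n-\ell$ with leading coefficient $c_n$ such that $$T_n^2(z)-1=H_{2\ell}(z)\,U_{n-\ell}^2(z),\qquad H_{2\ell}(z)=\prod_{j=1}^{2\ell}(z-a_j).$$ -/

import Mathlib

open Polynomial

/-- The inverse image `T⁻¹([-1,1]) = {z ∈ ℂ : T(z) ∈ [-1,1]}` of a complex polynomial. -/
def inverseImage (T : ℂ[X]) : Set ℂ :=
  {z : ℂ | ∃ t ∈ Set.Icc (-1 : ℝ) 1, T.eval z = (t : ℂ)}

/-- `C` is a Jordan arc with endpoints `p` and `q`: the image of an injective continuous map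
`γ : [0,1] → ℂ` with `γ 0 = p` and `γ 1 = q`. -/
def IsJordanArc (C : Set ℂ) (p q : ℂ) : Prop :=
  ∃ γ : Path p q, Function.Injective γ ∧ Set.range γ = C

/-- `S` consists of `k` Jordan arcs with endpoints `a₁, …, a₂ₖ`: it is the union of `k` Jordan
arcs, any two of which meet in at most finitely many points (they may touch or cross, but share no
subarc), and `a` lists the `2k` endpoints of these arcs in some order (the equivalence `e` says
which entries of the list belong to which arc). -/
def ConsistsOfJordanArcs (S : Set ℂ) (k : ℕ) (a : Fin (2 * k) → ℂ) : Prop :=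
  ∃ (C : Fin k → Set ℂ) (e : Fin k ⊕ Fin k ≃ Fin (2 * k)),
    (∀ j, IsJordanArc (C j) (a (e (Sum.inl j))) (a (e (Sum.inr j)))) ∧
    (⋃ j, C j) = S ∧
    Pairwise fun i j => (C i ∩ C j).Finite

/-! Near each point `z` a nonconstant `T` has the form `T(z) + w ^ m` in a local coordinate `w`.
Hence the inverse image is, near any of its points `z`, a star of branches: `2m` of them if `T(z)`
lies in `(-1, 1)`, and `m` if `T(z) = ±1`. In the latter case `m` is the multiplicity of `z` as a
zero of `T ^ 2 - 1`, so the number of branches always has the parity of that multiplicity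
(`odd_ncard_directions`). In any decomposition into arcs, an arc passing through `z` uses up two
branches and an arc ending at `z` one. So the zeros of odd multiplicity are exactly the points
listed an odd number of times as endpoints (`odd_card_endpoints_iff`); if the endpoints are
distinct, the two sets coincide.

In a decomposition with as few arcs as possible the endpoints are distinct, since two arcs with a
common endpoint could be merged into one (`endpoints_injective_of_minimal`). Merging requires that
the arcs do not meet again, that is, that the real locus of `T` contains no cycle
(`infinite_inter_of_common_endpoints`). A cycle would be a combination, with zero boundary, of
sections `σ i` of `T`. Testing it against polynomials `P` with `P' = Q * R(T) * T'` turns the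
boundary terms into integrals of `R(t) * Q(σ i t)`, because `T'(σ) σ' = 1`. As `R` is arbitrary, the
signed sum of the `Q(σ i t)` over the sections defined at `t` vanishes for almost every `t`; a `Q`
killing all sections but one at a good parameter gives a contradiction (`sections_independent`).

Some finite decomposition exists (`isFiniteArcUnion_inverseImage`), hence a minimal one, and its
endpoint set is forced; this gives the equivalence with the condition on zeros
(`minimal_decomposition_iff`). The factorization is that condition rewritten by splitting each
multiplicity into its remainder mod 2 and an even part. -/

open Filter Topology Set MeasureTheory

/-! ### Local power coordinates of a polynomial. -/

/-- The multiplicity with which `T` takes its value at `z`. -/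
noncomputable def valueMultiplicity (T : ℂ[X]) (z : ℂ) : ℕ :=
  (T - C (T.eval z)).rootMultiplicity z

lemma sub_C_ne_zero_of_natDegree_pos {T : ℂ[X]} (hT : 0 < T.natDegree) (c : ℂ) : T - C c ≠ 0 := by
  intro h
  rw [sub_eq_zero.mp h, natDegree_C] at hT
  exact lt_irrefl _ hT

lemma valueMultiplicity_pos {T : ℂ[X]} (hT : 0 < T.natDegree) (z : ℂ) :
    0 < valueMultiplicity T z := by
  rw [valueMultiplicity, rootMultiplicity_pos (sub_C_ne_zero_of_natDegree_pos hT _)]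
  simp [IsRoot]

/-- Near every point, a nonconstant polynomial is a power map in a suitable local coordinate. -/
lemma exists_local_coordinate {T : ℂ[X]} (hT : 0 < T.natDegree) (z : ℂ) {V : Set ℂ}
    (hV : V ∈ 𝓝 z) :
    ∃ (φ : OpenPartialHomeomorph ℂ ℂ) (ρ : ℝ), 0 < ρ ∧ φ.target = Metric.ball 0 ρ ∧
      z ∈ φ.source ∧ φ.source ⊆ V ∧ φ z = 0 ∧
      ∀ y ∈ φ.source, T.eval y = T.eval z + φ y ^ valueMultiplicity T z := by
  set m := valueMultiplicity T z with hm
  have hm0 : m ≠ 0 := (valueMultiplicity_pos hT z).ne'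
  obtain ⟨g, hg, hgz⟩ := exists_eq_pow_rootMultiplicity_mul_and_not_dvd (T - C (T.eval z))
    (sub_C_ne_zero_of_natDegree_pos hT _) z
  rw [dvd_iff_isRoot, IsRoot] at hgz
  change _ = (X - C z) ^ m * g at hg
  have hTg (y : ℂ) : T.eval y = T.eval z + (y - z) ^ m * g.eval y := by
    have := congrArg (eval y) hg
    simp at this
    linear_combination this
  set c : ℂ := (g.eval z) ^ ((m : ℂ)⁻¹) with hc
  have hcm : c ^ m = g.eval z := Complex.cpow_nat_inv_pow _ hm0
  have hc0 : c ≠ 0 := by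
    rintro h
    rw [h, zero_pow hm0] at hcm
    exact hgz hcm.symm
  -- Dividing by `g.eval z` puts the base near 1, away from the cut of the principal power; the lost
  -- factor is restored by `c`.
  let h : ℂ → ℂ := fun y => (g.eval y / g.eval z) ^ ((m : ℂ)⁻¹)
  have hh : AnalyticAt ℂ h z := by
    apply AnalyticAt.cpow
    · exact (AnalyticAt.div (AnalyticOnNhd.eval_polynomial g z (mem_univ _)) analyticAt_const hgz)
    · exact analyticAt_const
    · simp [div_self hgz, Complex.mem_slitPlane_iff]
  let w : ℂ → ℂ := fun y => c * ((y - z) * h y)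
  have hw : AnalyticAt ℂ w z :=
    analyticAt_const.mul ((analyticAt_id.sub analyticAt_const).mul hh)
  have hwd : HasDerivAt w c z := by
    have := (((hasDerivAt_id z).sub_const z).mul hh.differentiableAt.hasDerivAt).const_mul c
    simpa [h, div_self hgz, w] using this
  have hws : HasStrictDerivAt w c z := by
    have := hw.hasStrictDerivAt
    rwa [hwd.deriv] at this
  have hwm (y : ℂ) : w y ^ m = (y - z) ^ m * g.eval y := by
    simp only [w, mul_pow, hcm, h]
    rw [Complex.cpow_nat_inv_pow _ hm0]
    field_simp
  have hws' := hws.hasStrictFDerivAt_equiv hc0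
  set φ₀ := hws'.toOpenPartialHomeomorph w
  have hφ₀c (y : ℂ) : φ₀ y = w y := rfl
  have hz₀ : z ∈ φ₀.source := hws'.mem_toOpenPartialHomeomorph_source
  have hwz : w z = 0 := by simp [w]
  obtain ⟨V', hV'V, hV'o, hzV'⟩ := mem_nhds_iff.mp hV
  set φ₁ := φ₀.restrOpen V' hV'o
  have hz₁ : z ∈ φ₁.source := by simp [φ₁, hz₀, hzV']
  have h0 : (0 : ℂ) ∈ φ₁.target := by
    rw [← hwz]
    exact φ₁.map_source hz₁
  obtain ⟨ρ, hρ, hρt⟩ := Metric.isOpen_iff.mp φ₁.open_target 0 h0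
  -- Restricting the inverse chart, not the chart, is what makes the target exactly a disc.
  set φ := (φ₁.symm.restrOpen (Metric.ball 0 ρ) Metric.isOpen_ball).symm
  have hsrc : φ.source ⊆ φ₁.source := by
    intro y hy
    have h1 := φ.map_source hy
    have h2 := φ.left_inv hy
    have h3 : φ y ∈ φ₁.target := by
      have : φ.target = φ₁.target ∩ Metric.ball 0 ρ := rfl
      rw [this] at h1
      exact h1.1
    rw [← h2]
    exact φ₁.map_target h3
  refine ⟨φ, ρ, hρ, ?_, ?_, ?_, ?_, ?_⟩
  · have : φ.target = φ₁.target ∩ Metric.ball 0 ρ := rfl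
    rw [this, inter_eq_right.mpr hρt]
  · have h1 : (0 : ℂ) ∈ φ.target := ⟨h0, Metric.mem_ball_self hρ⟩
    have h2 := φ.map_target h1
    have h3 : φ.symm 0 = z := by
      have : φ₁.symm (φ₁ z) = z := φ₁.left_inv hz₁
      rw [show φ₁ z = 0 from hwz] at this
      exact this
    rwa [h3] at h2
  · intro y hy
    have h1 := hsrc hy
    simp only [φ₁, OpenPartialHomeomorph.restrOpen_source] at h1
    exact hV'V h1.2
  · exact hwz
  · intro y _
    rw [hTg y, ← hwm y]
    rfl

/-! ### Subdivision of intervals and parametrization of Jordan arcs. -/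

/-- A transitive relation on intervals that holds on all short intervals to the right and to the
left of every point holds on the whole interval. -/
lemma interval_chain {R : ℝ → ℝ → Prop} {a b : ℝ} (hab : a < b)
    (trans : ∀ x y z, a ≤ x → x < y → y < z → z ≤ b → R x y → R y z → R x z)
    (right : ∀ x, a ≤ x → x < b → ∃ η > 0, ∀ s t, x ≤ s → s < t → t < x + η → t ≤ b → R s t)
    (left : ∀ x, a < x → x ≤ b → ∃ η > 0, ∀ s t, x - η < s → s < t → t ≤ x → a ≤ s → R s t) :
    R a b := by
  have loc : ∀ x : Icc a b, ∃ η > 0, ∀ s t, |s - x.1| < η → |t - x.1| < η → s < t → a ≤ s →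
      t ≤ b → R s t := by
    rintro ⟨x, hax, hxb⟩
    obtain ⟨η₁, h₁, H₁⟩ : ∃ η > 0, ∀ s t, x ≤ s → s < t → t < x + η → t ≤ b → R s t := by
      rcases hxb.lt_or_eq with h | h
      · exact right x hax h
      · exact ⟨1, one_pos, fun s t h1 h2 _ h4 => by linarith⟩
    obtain ⟨η₂, h₂, H₂⟩ : ∃ η > 0, ∀ s t, x - η < s → s < t → t ≤ x → a ≤ s → R s t := by
      rcases hax.lt_or_eq with h | h
      · exact left x h hxb
      · exact ⟨1, one_pos, fun s t h1 h2 _ h4 => by linarith⟩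
    refine ⟨min η₁ η₂, lt_min h₁ h₂, fun s t hs ht hst has htb => ?_⟩
    simp only [abs_lt, lt_min_iff] at hs ht
    rcases le_or_gt x s with h | h
    · exact H₁ s t h hst (by linarith [ht.2.1]) htb
    · rcases le_or_gt t x with h' | h'
      · exact H₂ s t (by linarith [hs.1, min_le_right η₁ η₂]) hst h' has
      · exact trans s x t has h h' htb
          (H₂ s x (by linarith [hs.1, min_le_right η₁ η₂]) h le_rfl has)
          (H₁ x t le_rfl h' (by linarith [ht.2.1]) htb)
  choose η hη H using loc
  obtain ⟨t, ht0, htm, ⟨M, hM⟩, hc⟩ := exists_monotone_Icc_subset_open_cover_Icc hab.le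
    (c := fun x : Icc a b => Metric.ball x (η x)) (fun _ => Metric.isOpen_ball)
    (fun x _ => mem_iUnion.mpr ⟨x, Metric.mem_ball_self (hη x)⟩)
  -- Subdivision points may coincide with each other or with `a`, and nothing is known about `R x
  -- x`; hence the condition `a < t n`.
  have key : ∀ n, a < t n → R a (t n) := by
    intro n
    induction n with
    | zero => intro h; exact absurd ht0 h.ne'
    | succ n ih =>
      intro h
      obtain ⟨x, hx⟩ := hc n
      have hle : t n ≤ t (n + 1) := htm n.le_succ
      have h1 := hx ⟨le_rfl, hle⟩
      have h2 := hx ⟨hle, le_rfl⟩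
      rw [Metric.mem_ball, Subtype.dist_eq, Real.dist_eq] at h1 h2
      rcases (show (t n : ℝ) ≤ t (n + 1) from hle).lt_or_eq with hlt | heq
      · have hstep := H x _ _ h1 h2 hlt (t n).2.1 (t (n + 1)).2.2
        rcases (t n).2.1.lt_or_eq with h3 | h3
        · exact trans _ _ _ le_rfl h3 hlt (t (n + 1)).2.2 (ih h3) hstep
        · rwa [← h3] at hstep
      · rw [← heq] at h ⊢
        exact ih h
  have := key M
  rw [hM M le_rfl] at this
  exact this hab

lemma IsJordanArc.exists_param {K : Set ℂ} {p q : ℂ} (h : IsJordanArc K p q) :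
    ∃ f : ℝ → ℂ, Continuous f ∧ InjOn f (Icc 0 1) ∧ f 0 = p ∧ f 1 = q ∧ f '' Icc 0 1 = K := by
  obtain ⟨γ, hγ, hr⟩ := h
  refine ⟨γ.extend, γ.continuous_extend, ?_, by simp, by simp, ?_⟩
  · intro x hx y hy hxy
    rw [γ.extend_apply hx, γ.extend_apply hy] at hxy
    exact congrArg Subtype.val (hγ hxy)
  · rw [← hr]
    ext z
    constructor
    · rintro ⟨x, hx, rfl⟩
      exact ⟨⟨x, hx⟩, (γ.extend_apply hx).symm⟩
    · rintro ⟨x, rfl⟩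
      exact ⟨x, x.2, γ.extend_apply x.2⟩

lemma isJordanArc_image {f : ℝ → ℂ} {a b : ℝ} (hab : a < b) (hf : ContinuousOn f (Icc a b))
    (hi : InjOn f (Icc a b)) : IsJordanArc (f '' Icc a b) (f a) (f b) := by
  have hmem (x : unitInterval) : a + x * (b - a) ∈ Icc a b := by
    have := x.2.1
    have := x.2.2
    constructor <;> nlinarith
  refine ⟨⟨⟨fun x => f (a + x * (b - a)), ?_⟩, by simp, by simp⟩, ?_, ?_⟩
  · exact hf.comp_continuous (by fun_prop) hmem
  · intro x y hxy
    have := hi (hmem x) (hmem y) hxy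
    have hba : b - a ≠ 0 := by linarith
    exact Subtype.ext (mul_right_cancel₀ hba (add_left_cancel this))
  · ext z
    constructor
    · rintro ⟨x, rfl⟩
      exact ⟨_, hmem x, rfl⟩
    · rintro ⟨y, hy, rfl⟩
      refine ⟨⟨(y - a) / (b - a), div_nonneg (by linarith [hy.1]) (by linarith),
        (div_le_one (by linarith)).mpr (by linarith [hy.2])⟩, ?_⟩
      change f _ = _
      congr 1
      have hba : b - a ≠ 0 := by linarith
      simp only
      field_simp
      ring

lemma IsJordanArc.symm {K : Set ℂ} {p q : ℂ} (h : IsJordanArc K p q) : IsJordanArc K q p := by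
  obtain ⟨γ, hγ, hr⟩ := h
  exact ⟨γ.symm, hγ.comp (unitInterval.symm_bijective.injective), by rw [Path.symm_range, hr]⟩

lemma IsJordanArc.ne {K : Set ℂ} {p q : ℂ} (h : IsJordanArc K p q) : p ≠ q := by
  obtain ⟨γ, hγ, -⟩ := h
  intro hpq
  exact zero_ne_one (hγ ((γ.source.trans hpq).trans γ.target.symm))

lemma IsJordanArc.isCompact {K : Set ℂ} {p q : ℂ} (h : IsJordanArc K p q) : IsCompact K := by
  obtain ⟨γ, -, rfl⟩ := h
  exact isCompact_range γ.continuous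

lemma IsJordanArc.left_mem {K : Set ℂ} {p q : ℂ} (h : IsJordanArc K p q) : p ∈ K := by
  obtain ⟨γ, -, rfl⟩ := h
  exact ⟨0, γ.source⟩

lemma IsJordanArc.right_mem {K : Set ℂ} {p q : ℂ} (h : IsJordanArc K p q) : q ∈ K :=
  h.symm.left_mem

/-! ### Integration along sections and their independence. -/

lemma Polynomial.exists_derivative_eq (p : ℂ[X]) : ∃ P : ℂ[X], derivative P = p := by
  induction p using Polynomial.induction_on' with
  | add p q hp hq =>
    obtain ⟨P, rfl⟩ := hp
    obtain ⟨Q, rfl⟩ := hq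
    exact ⟨P + Q, derivative_add⟩
  | monomial n a =>
    refine ⟨monomial (n + 1) (a / (n + 1)), ?_⟩
    rw [derivative_monomial]
    have : (n : ℂ) + 1 ≠ 0 := Nat.cast_add_one_ne_zero n
    simp [this]

/-- The real parameters over which `T` has a critical point form a finite set. -/
lemma finite_real_criticalValues {T : ℂ[X]} (hT : 0 < T.natDegree) :
    {t : ℝ | ∃ z, (derivative T).eval z = 0 ∧ T.eval z = t}.Finite := by
  have hd : derivative T ≠ 0 := fun h => hT.ne' (derivative_eq_zero.mp h)
  have h1 : {z | (derivative T).eval z = 0}.Finite := by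
    refine (derivative T).roots.toFinset.finite_toSet.subset fun z hz => ?_
    simpa [hd] using hz
  refine ((h1.image fun z => (T.eval z).re)).subset ?_
  rintro t ⟨z, hz, ht⟩
  exact ⟨z, hz, by simp [ht]⟩

/-- A continuous real section of a polynomial is differentiable away from the critical points. -/
lemma hasDerivAt_section {T : ℂ[X]} {σ : ℝ → ℂ} {t : ℝ} (hσ : ContinuousAt σ t)
    (hT : ∀ᶠ s in 𝓝 t, T.eval (σ s) = (s : ℂ)) (hd : (derivative T).eval (σ t) ≠ 0) :
    HasDerivAt σ ((derivative T).eval (σ t))⁻¹ t := by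
  have h1 : HasStrictDerivAt (fun z => T.eval z) ((derivative T).eval (σ t)) (σ t) :=
    T.hasStrictDerivAt _
  have h2 := (h1.to_localInverse hd).hasDerivAt
  simp only [hT.self_of_nhds] at h2
  refine h2.comp_ofReal.congr_of_eventuallyEq ?_
  filter_upwards [hσ.eventually (h1.eventually_left_inverse hd), hT] with s h3 h4
  rw [h4] at h3
  exact h3.symm

/-- Integration of a polynomial expression along a section of a polynomial. -/
lemma integral_section {T : ℂ[X]} (hT : 0 < T.natDegree) {α β : ℝ} (hαβ : α ≤ β) {σ : ℝ → ℂ}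
    (hσ : ContinuousOn σ (Icc α β)) (hs : ∀ t ∈ Icc α β, T.eval (σ t) = (t : ℂ))
    {P Q R : ℂ[X]} (hP : derivative P = Q * R.comp T * derivative T) :
    ∫ t in α..β, R.eval (t : ℂ) * Q.eval (σ t) = P.eval (σ β) - P.eval (σ α) := by
  -- Over the finitely many critical values `σ` is merely continuous, which the fundamental theorem
  -- of calculus tolerates.
  refine integral_eq_of_hasDerivAt_off_countable_of_le (fun t => P.eval (σ t)) _ hαβ
    (finite_real_criticalValues hT).countable ?_ ?_ ?_
  · exact P.continuous.comp_continuousOn hσ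
  · rintro t ⟨ht, hc⟩
    have htI := Ioo_subset_Icc_self ht
    have hd : (derivative T).eval (σ t) ≠ 0 := fun h => hc ⟨σ t, h, hs t htI⟩
    have h1 := hasDerivAt_section (hσ.continuousAt (Icc_mem_nhds ht.1 ht.2))
      (by filter_upwards [Icc_mem_nhds ht.1 ht.2] with s h using hs s h) hd
    have h2 := (P.hasDerivAt (σ t)).comp_of_eq t h1 rfl
    refine h2.congr_deriv ?_
    rw [hP]
    simp only [eval_mul, eval_comp, hs t htI]
    field_simp
  · apply ContinuousOn.intervalIntegrable
    rw [uIcc_of_le hαβ]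
    exact (R.continuous.comp Complex.continuous_ofReal).continuousOn.mul
      (Q.continuous.comp_continuousOn hσ)

/-- Continuous real sections of a polynomial which are pairwise distinct up to finitely many
parameters are homologically independent, as seen by polynomial test functions: no nontrivial
combination of them has zero boundary. -/
lemma sections_independent {T : ℂ[X]} (hT : 0 < T.natDegree) {ι : Type*} [Fintype ι] [Nonempty ι]
    (α β : ι → ℝ) (hαβ : ∀ i, α i < β i) (σ : ι → ℝ → ℂ)
    (hσ : ∀ i, ContinuousOn (σ i) (Icc (α i) (β i)))
    (hs : ∀ i, ∀ t ∈ Icc (α i) (β i), T.eval (σ i t) = (t : ℂ))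
    (hd : Pairwise fun i j =>
      {t | t ∈ Icc (α i) (β i) ∧ t ∈ Icc (α j) (β j) ∧ σ i t = σ j t}.Finite)
    (ε : ι → ℂ) (hε : ∀ i, ε i ≠ 0)
    (hP : ∀ P : ℂ[X], ∑ i, ε i * (P.eval (σ i (β i)) - P.eval (σ i (α i))) = 0) : False := by
  classical
  obtain ⟨i₀⟩ := ‹Nonempty ι›
  -- Off this finite set the sections are pairwise distinct, and the indicator functions of the
  -- parameter intervals are locally constant.
  set bad : Set ℝ := range α ∪ range β ∪ ⋃ i, ⋃ j, ⋃ (_ : i ≠ j),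
    {t | t ∈ Icc (α i) (β i) ∧ t ∈ Icc (α j) (β j) ∧ σ i t = σ j t} with hbad
  have hbadf : bad.Finite := by
    refine ((finite_range _).union (finite_range _)).union ?_
    exact finite_iUnion fun i => finite_iUnion fun j => finite_iUnion fun hij => hd hij
  obtain ⟨t₀, ht₀, ht₀b⟩ := ((Ioo_infinite (hαβ i₀)).sdiff hbadf).nonempty
  -- `Q` separates the sections at `t₀`: it vanishes on all those defined there except `σ i₀`.
  let Q : ℂ[X] := ∏ i ∈ Finset.univ.filter (fun i => i ≠ i₀ ∧ t₀ ∈ Icc (α i) (β i)),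
    (X - C (σ i t₀))
  have hQ₀ : Q.eval (σ i₀ t₀) ≠ 0 := by
    simp only [Q, eval_prod, Finset.prod_ne_zero_iff]
    intro i hi
    simp only [Finset.mem_filter, Finset.mem_univ, true_and] at hi
    simp only [eval_sub, eval_X, eval_C, sub_ne_zero]
    intro h
    refine ht₀b (Or.inr ?_)
    simp only [mem_iUnion]
    exact ⟨i₀, i, hi.1.symm, Ioo_subset_Icc_self ht₀, hi.2, h⟩
  have hQ (i) (hi : i ≠ i₀) (hi' : t₀ ∈ Icc (α i) (β i)) : Q.eval (σ i t₀) = 0 := by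
    simp only [Q, eval_prod]
    exact Finset.prod_eq_zero (i := i) (by simp [hi, hi'.1, hi'.2]) (by simp)
  have hpoly (R : ℂ[X]) :
      ∑ i, ε i * ∫ t in α i..β i, R.eval (t : ℂ) * Q.eval (σ i t) = 0 := by
    obtain ⟨P, hPd⟩ := exists_derivative_eq (Q * R.comp T * derivative T)
    rw [← hP P]
    exact Finset.sum_congr rfl fun i _ => by
      rw [integral_section hT (hαβ i).le (hσ i) (hs i) hPd]
  have hQσ (i) : ContinuousOn (fun t => Q.eval (σ i t)) (Icc (α i) (β i)) :=
    Q.continuous.comp_continuousOn (hσ i)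
  -- By Weierstrass approximation on `[A, B]`, which contains all parameter intervals, the
  -- polynomial weight `R` can be replaced by a continuous one.
  have hcont (g : ℝ → ℝ) (hg : Continuous g) :
      ∑ i, ε i * ∫ t in α i..β i, (g t : ℂ) * Q.eval (σ i t) = 0 := by
    set A := Finset.univ.inf' ⟨i₀, Finset.mem_univ _⟩ α
    set B := Finset.univ.sup' ⟨i₀, Finset.mem_univ _⟩ β
    have hA (i) : A ≤ α i := Finset.inf'_le _ (Finset.mem_univ i)
    have hB (i) : β i ≤ B := Finset.le_sup' _ (Finset.mem_univ i)
    set K : ℝ := ∑ i, ‖ε i‖ * ∫ t in α i..β i, ‖Q.eval (σ i t)‖ with hK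
    have hK0 : 0 ≤ K := Finset.sum_nonneg fun i _ => mul_nonneg (norm_nonneg _)
      (intervalIntegral.integral_nonneg (hαβ i).le fun _ _ => norm_nonneg _)
    have hint (i) (f : ℝ → ℂ) (hf : Continuous f) :
        IntervalIntegrable (fun t => f t * Q.eval (σ i t)) volume (α i) (β i) := by
      apply ContinuousOn.intervalIntegrable
      rw [uIcc_of_le (hαβ i).le]
      exact hf.continuousOn.mul (hQσ i)
    have hbound (δ : ℝ) (hδ : 0 < δ) :
        ‖∑ i, ε i * ∫ t in α i..β i, (g t : ℂ) * Q.eval (σ i t)‖ ≤ δ * K := by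
      obtain ⟨r, hr⟩ := exists_polynomial_near_of_continuousOn A B g hg.continuousOn δ hδ
      have hrc : Continuous fun t : ℝ => ((r.map (algebraMap ℝ ℂ)).eval (t : ℂ)) :=
        (r.map (algebraMap ℝ ℂ)).continuous.comp Complex.continuous_ofReal
      have hgc : Continuous fun t : ℝ => (g t : ℂ) := Complex.continuous_ofReal.comp hg
      rw [← sub_zero (∑ i, _), ← hpoly (r.map (algebraMap ℝ ℂ)), ← Finset.sum_sub_distrib,
        hK, Finset.mul_sum]
      refine (norm_sum_le _ _).trans (Finset.sum_le_sum fun i _ => ?_)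
      rw [← mul_sub, ← intervalIntegral.integral_sub (hint i _ hgc) (hint i _ hrc), norm_mul,
        mul_left_comm]
      refine mul_le_mul_of_nonneg_left ?_ (norm_nonneg _)
      rw [← intervalIntegral.integral_const_mul]
      refine intervalIntegral.norm_integral_le_of_norm_le (hαβ i).le ?_ ?_
      · refine Eventually.of_forall fun t ht => ?_
        rw [← sub_mul, norm_mul]
        refine mul_le_mul_of_nonneg_right ?_ (norm_nonneg _)
        have h1 : (r.map (algebraMap ℝ ℂ)).eval (t : ℂ) = ((r.eval t : ℝ) : ℂ) := by
          rw [eval_map]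
          exact eval₂_at_apply (algebraMap ℝ ℂ) t
        rw [h1, ← Complex.ofReal_sub, Complex.norm_real, Real.norm_eq_abs, abs_sub_comm]
        exact (hr t ⟨(hA i).trans ht.1.le, ht.2.trans (hB i)⟩).le
      · apply ContinuousOn.intervalIntegrable
        rw [uIcc_of_le (hαβ i).le]
        exact continuousOn_const.mul (hQσ i).norm
    rw [← norm_le_zero_iff]
    refine le_of_forall_pos_le_add fun e he => ?_
    refine (hbound (e / (K + 1)) (by positivity)).trans ?_
    rw [zero_add, div_mul_eq_mul_div, div_le_iff₀ (by positivity)]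
    nlinarith
  -- The identities above say that `h` integrates to zero against every test function, so it
  -- vanishes almost everywhere. But at `t₀` it is continuous with the nonzero value `ε i₀ * Q(σ i₀
  -- t₀)`.
  let h : ℝ → ℂ := fun t => ∑ i, (Icc (α i) (β i)).indicator (fun t => ε i * Q.eval (σ i t)) t
  have hi (i) : Integrable ((Icc (α i) (β i)).indicator (fun t => ε i * Q.eval (σ i t))) := by
    rw [integrable_indicator_iff measurableSet_Icc]
    exact (continuousOn_const.mul (hQσ i)).integrableOn_Icc
  have hae : ∀ᵐ t, h t = 0 := by
    apply ae_eq_zero_of_integral_contDiff_smul_eq_zero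
    · exact (integrable_finsetSum _ fun i _ => hi i).locallyIntegrable
    · intro g hg hgs
      rw [← hcont g hg.continuous]
      simp only [h, Finset.smul_sum]
      rw [integral_finsetSum]
      · refine Finset.sum_congr rfl fun i _ => ?_
        rw [← intervalIntegral.integral_const_mul, intervalIntegral.integral_of_le (hαβ i).le,
          ← integral_Icc_eq_integral_Ioc, ← integral_indicator measurableSet_Icc]
        congr 1
        ext t
        by_cases ht : t ∈ Icc (α i) (β i)
        · simp only [indicator_of_mem ht, Complex.real_smul]
          ring
        · simp only [indicator_of_notMem ht, smul_zero]
      · intro i _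
        exact (hi i).locallyIntegrable.integrable_smul_left_of_hasCompactSupport hg.continuous hgs
  have hht₀ : h t₀ ≠ 0 := by
    have : h t₀ = ε i₀ * Q.eval (σ i₀ t₀) := by
      simp only [h]
      rw [Finset.sum_eq_single i₀, indicator_of_mem (Ioo_subset_Icc_self ht₀)]
      · intro i _ hii
        by_cases ht : t₀ ∈ Icc (α i) (β i)
        · rw [indicator_of_mem ht, hQ i hii ht, mul_zero]
        · rw [indicator_of_notMem ht]
      · simp
    rw [this]
    exact mul_ne_zero (hε _) hQ₀
  have hcontAt : ContinuousAt h t₀ := by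
    apply tendsto_finsetSum
    intro i _
    change ContinuousAt _ _
    have h1 : t₀ ≠ α i := fun h => ht₀b (Or.inl (Or.inl ⟨i, h.symm⟩))
    have h2 : t₀ ≠ β i := fun h => ht₀b (Or.inl (Or.inr ⟨i, h.symm⟩))
    by_cases ht : t₀ ∈ Icc (α i) (β i)
    · have hn : Icc (α i) (β i) ∈ 𝓝 t₀ :=
        Icc_mem_nhds (lt_of_le_of_ne ht.1 h1.symm) (lt_of_le_of_ne ht.2 h2)
      refine ((continuousOn_const.mul (hQσ i)).continuousAt hn :
        ContinuousAt (fun t => ε i * Q.eval (σ i t)) t₀).congr ?_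
      filter_upwards [hn] with t h
      rw [indicator_of_mem h]
      rfl
    · refine (continuousAt_const (y := (0 : ℂ))).congr ?_
      filter_upwards [isClosed_Icc.isOpen_compl.mem_nhds ht] with t h
      rw [indicator_of_notMem h]
  have hpos := Measure.measure_pos_of_mem_nhds (volume : Measure ℝ)
    (hcontAt.eventually_ne hht₀)
  exact hpos.ne' hae

/-! ### Power charts and curves along which the polynomial is real. -/

lemma finite_pow_eq {m : ℕ} (hm : m ≠ 0) (a : ℂ) : {ζ : ℂ | ζ ^ m = a}.Finite := by
  refine (nthRoots m a).toFinset.finite_toSet.subset fun ζ hζ => ?_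
  simpa [mem_nthRoots (Nat.pos_of_ne_zero hm)] using hζ

/-- A chart at `z` in which `T` becomes a power map, with a disc as its range. -/
structure PowerChart (T : ℂ[X]) (z : ℂ) where
  chart : OpenPartialHomeomorph ℂ ℂ
  radius : ℝ
  radius_pos : 0 < radius
  target_eq : chart.target = Metric.ball 0 radius
  mem_source : z ∈ chart.source
  map_center : chart z = 0
  eval_eq : ∀ y ∈ chart.source, T.eval y = T.eval z + chart y ^ valueMultiplicity T z

lemma exists_powerChart {T : ℂ[X]} (hT : 0 < T.natDegree) (z : ℂ) {V : Set ℂ} (hV : V ∈ 𝓝 z) :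
    ∃ Φ : PowerChart T z, Φ.chart.source ⊆ V := by
  obtain ⟨φ, ρ, h1, h2, h3, h4, h5, h6⟩ := exists_local_coordinate hT z hV
  exact ⟨⟨φ, ρ, h1, h2, h3, h5, h6⟩, h4⟩

namespace PowerChart

variable {T : ℂ[X]} {z : ℂ} (Φ : PowerChart T z)

lemma chart_ne_zero {y : ℂ} (hy : y ∈ Φ.chart.source) (hyz : y ≠ z) : Φ.chart y ≠ 0 := by
  intro h
  exact hyz (Φ.chart.injOn hy Φ.mem_source (h.trans Φ.map_center.symm))

/-- A curve leaving `z` along which `T` is real initially follows a single ray of the chart. -/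
lemma exists_ray (hT : 0 < T.natDegree) {f : ℝ → ℂ} {s b : ℝ} (hsb : s < b)
    (hf : ContinuousOn f (Icc s b)) (hfs : f s = z) (hne : ∀ t ∈ Ioc s b, f t ≠ z)
    (hr : ∀ t ∈ Icc s b, ∃ r : ℝ, T.eval (f t) = r) :
    ∃ η > 0, s + η ≤ b ∧ ∃ ζ : ℂ, (ζ ^ valueMultiplicity T z = 1 ∨ ζ ^ valueMultiplicity T z = -1) ∧
      ∀ t ∈ Icc s (s + η), f t ∈ Φ.chart.source ∧ Φ.chart (f t) = ζ * (‖Φ.chart (f t)‖ : ℝ) := by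
  set m := valueMultiplicity T z with hm
  have hm0 : m ≠ 0 := (valueMultiplicity_pos hT z).ne'
  have h1 : ∀ᶠ t in 𝓝[Icc s b] s, f t ∈ Φ.chart.source :=
    (hf s (left_mem_Icc.mpr hsb.le)).eventually_mem
      (Φ.chart.open_source.mem_nhds (hfs ▸ Φ.mem_source))
  rw [nhdsWithin_Icc_eq_nhdsGE hsb] at h1
  obtain ⟨c, hc, hcs⟩ := mem_nhdsGE_iff_exists_Icc_subset.mp h1
  set η := min (c - s) (b - s)
  have hη0 : 0 < η := lt_min (sub_pos.mpr hc) (sub_pos.mpr hsb)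
  have hsrc : ∀ t ∈ Icc s (s + η), f t ∈ Φ.chart.source := fun t ht =>
    hcs ⟨ht.1, by linarith [ht.2, min_le_left (c - s) (b - s)]⟩
  have hb : s + η ≤ b := by linarith [min_le_right (c - s) (b - s)]
  have hsub : Icc s (s + η) ⊆ Icc s b := Icc_subset_Icc_right hb
  have hw : ContinuousOn (fun t => Φ.chart (f t)) (Icc s (s + η)) :=
    Φ.chart.continuousOn.comp (hf.mono hsub) hsrc
  have hw0 : ∀ t ∈ Ioc s (s + η), Φ.chart (f t) ≠ 0 := fun t ht =>
    Φ.chart_ne_zero (hsrc t (Ioc_subset_Icc_self ht)) (hne t ⟨ht.1, ht.2.trans hb⟩)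
  -- The direction of the curve in the chart is continuous for `t > s` and, `T` being real, its
  -- `m`-th power is `±1`. A continuous map from an interval to a finite set is constant.
  set u : ℝ → ℂ := fun t => Φ.chart (f t) / (‖Φ.chart (f t)‖ : ℝ) with hu
  have huc : ContinuousOn u (Ioc s (s + η)) := by
    have hw' := hw.mono Ioc_subset_Icc_self
    refine hw'.div (Complex.continuous_ofReal.comp_continuousOn hw'.norm) fun t ht => ?_
    exact Complex.ofReal_ne_zero.mpr (norm_ne_zero_iff.mpr (hw0 t ht))
  obtain ⟨r₀, hr₀⟩ := hr s (left_mem_Icc.mpr hsb.le)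
  rw [hfs] at hr₀
  have hum : MapsTo u (Ioc s (s + η)) {ζ | ζ ^ m = 1 ∨ ζ ^ m = -1} := by
    intro t ht
    have htI := Ioc_subset_Icc_self ht
    obtain ⟨r, hrt⟩ := hr t (hsub htI)
    have h2 := Φ.eval_eq _ (hsrc t htI)
    rw [hrt, hr₀] at h2
    have h3 : Φ.chart (f t) ^ m = ((r - r₀ : ℝ) : ℂ) := by
      push_cast
      linear_combination -h2
    have h4 : ‖Φ.chart (f t)‖ ^ m = |r - r₀| := by
      rw [← norm_pow, h3, Complex.norm_real, Real.norm_eq_abs]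
    have h5 : r - r₀ ≠ 0 := by
      intro h
      rw [h, Complex.ofReal_zero] at h3
      exact hw0 t ht (pow_eq_zero_iff hm0 |>.mp h3)
    have h6 : u t ^ m = (((r - r₀) / |r - r₀| : ℝ) : ℂ) := by
      rw [hu]
      simp only [div_pow, h3, ← Complex.ofReal_pow, h4, Complex.ofReal_div]
    simp only [mem_ofPred_eq, h6]
    rcases lt_or_gt_of_ne h5 with h | h
    · right
      rw [abs_of_neg h, div_neg, div_self h5]
      simp
    · left
      rw [abs_of_pos h, div_self h5]
      simp
  have hfin : {ζ : ℂ | ζ ^ m = 1 ∨ ζ ^ m = -1}.Finite :=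
    (finite_pow_eq hm0 1).union (finite_pow_eq hm0 (-1))
  have hend : s + η ∈ Ioc s (s + η) := ⟨by linarith, le_rfl⟩
  refine ⟨η, hη0, hb, u (s + η), hum hend, fun t ht => ⟨hsrc t ht, ?_⟩⟩
  rcases ht.1.eq_or_lt with h | h
  · rw [← h, hfs, Φ.map_center]
    simp
  · have ht' : t ∈ Ioc s (s + η) := ⟨h, ht.2⟩
    rw [← isPreconnected_Ioc.constant_of_mapsTo hfin.isDiscrete huc hum ht' hend]
    have := Complex.ofReal_ne_zero.mpr (norm_ne_zero_iff.mpr (hw0 t ht'))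
    simp only [hu]
    field_simp

end PowerChart

/-- A polynomial that is real along an injective curve is initially injective along it. -/
lemma exists_injOn_eval_right {T : ℂ[X]} (hT : 0 < T.natDegree) {f : ℝ → ℂ} {s b : ℝ} (hsb : s < b)
    (hf : ContinuousOn f (Icc s b)) (hi : InjOn f (Icc s b))
    (hr : ∀ t ∈ Icc s b, ∃ r : ℝ, T.eval (f t) = r) :
    ∃ η > 0, s + η ≤ b ∧ InjOn (fun t => T.eval (f t)) (Icc s (s + η)) := by
  obtain ⟨Φ, -⟩ := exists_powerChart hT (f s) univ_mem
  obtain ⟨η, hη, hb, ζ, hζ, H⟩ := Φ.exists_ray hT hsb hf rfl (fun t ht h =>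
    ht.1.ne' (hi (Ioc_subset_Icc_self ht) (left_mem_Icc.mpr hsb.le) h)) hr
  refine ⟨η, hη, hb, fun x hx y hy hxy => ?_⟩
  have hm0 : valueMultiplicity T (f s) ≠ 0 := (valueMultiplicity_pos hT _).ne'
  have hζ0 : ζ ^ valueMultiplicity T (f s) ≠ 0 := by
    rcases hζ with h | h <;> simp [h]
  simp only at hxy
  -- On a single ray the value of `T` determines the modulus of the chart coordinate, hence the
  -- point.
  rw [Φ.eval_eq _ (H x hx).1, Φ.eval_eq _ (H y hy).1, (H x hx).2, (H y hy).2, mul_pow, mul_pow,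
    add_right_inj, mul_right_inj' hζ0, ← Complex.ofReal_pow, ← Complex.ofReal_pow,
    Complex.ofReal_inj, pow_left_inj₀ (norm_nonneg _) (norm_nonneg _) hm0] at hxy
  have h1 : Φ.chart (f x) = Φ.chart (f y) := by rw [(H x hx).2, (H y hy).2, hxy]
  have hsub : Icc s (s + η) ⊆ Icc s b := Icc_subset_Icc_right hb
  exact hi (hsub hx) (hsub hy) (Φ.chart.injOn (H x hx).1 (H y hy).1 h1)

lemma exists_injOn_eval_left {T : ℂ[X]} (hT : 0 < T.natDegree) {f : ℝ → ℂ} {a s : ℝ} (has : a < s)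
    (hf : ContinuousOn f (Icc a s)) (hi : InjOn f (Icc a s))
    (hr : ∀ t ∈ Icc a s, ∃ r : ℝ, T.eval (f t) = r) :
    ∃ η > 0, a ≤ s - η ∧ InjOn (fun t => T.eval (f t)) (Icc (s - η) s) := by
  have hm : MapsTo (fun t : ℝ => -t) (Icc (-s) (-a)) (Icc a s) := fun t ht =>
    ⟨by linarith [ht.2], by linarith [ht.1]⟩
  obtain ⟨η, hη, hb, H⟩ := exists_injOn_eval_right hT (f := fun t => f (-t)) (neg_lt_neg has)
    (hf.comp continuousOn_neg hm) (hi.comp neg_injective.injOn hm) (fun t ht => hr _ (hm ht))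
  refine ⟨η, hη, by linarith, fun x hx y hy hxy => ?_⟩
  have := @H (-x) ⟨by linarith [hx.2], by linarith [hx.1]⟩ (-y)
    ⟨by linarith [hy.2], by linarith [hy.1]⟩ (by simpa using hxy)
  exact neg_injective this

/-! ### Curves as chains of sections, and the absence of cycles. -/

/-- The curve `f` on `[s, t]` is, as a chain tested against polynomials, a combination of
sections of `T` with values on that curve and with finite pairwise coincidence sets. -/
def IsSectionChain (T : ℂ[X]) (f : ℝ → ℂ) (s t : ℝ) : Prop :=
  ∃ (ι : Type) (_ : Fintype ι) (α β : ι → ℝ) (σ : ι → ℝ → ℂ) (ε : ι → ℂ),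
    (∀ i, α i < β i) ∧ (∀ i, ContinuousOn (σ i) (Icc (α i) (β i))) ∧
    (∀ i, ∀ x ∈ Icc (α i) (β i), T.eval (σ i x) = (x : ℂ) ∧ σ i x ∈ f '' Icc s t) ∧
    (Pairwise fun i j => {x | x ∈ Icc (α i) (β i) ∧ x ∈ Icc (α j) (β j) ∧ σ i x = σ j x}.Finite) ∧
    (∀ i, ε i ≠ 0) ∧
    ∀ P : ℂ[X], ∑ i, ε i * (P.eval (σ i (β i)) - P.eval (σ i (α i))) = P.eval (f t) - P.eval (f s)

lemma continuousOn_invFunOn_image {K : Set ℝ} (hK : IsCompact K) {u : ℝ → ℝ}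
    (hu : ContinuousOn u K) (hi : InjOn u K) : ContinuousOn (Function.invFunOn u K) (u '' K) := by
  rw [continuousOn_iff_isClosed]
  intro F hF
  refine ⟨u '' (K ∩ F), ((hK.inter_right hF).image_of_continuousOn
    (hu.mono inter_subset_left)).isClosed, ?_⟩
  ext y
  constructor
  · rintro ⟨h1, x, hx, rfl⟩
    rw [mem_preimage, hi.leftInvOn_invFunOn hx] at h1
    exact ⟨⟨x, ⟨hx, h1⟩, rfl⟩, x, hx, rfl⟩
  · rintro ⟨⟨x, ⟨hx, h1⟩, rfl⟩, -⟩
    refine ⟨?_, x, hx, rfl⟩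
    rwa [mem_preimage, hi.leftInvOn_invFunOn hx]

/-- The real function `T ∘ f` is injective and continuous, hence strictly monotone, so the curve can
be reparametrized by the value of `T`. The single coefficient `1` or `-1` records whether `T`
increases or decreases along `f`. -/
lemma isSectionChain_of_injOn_eval {T : ℂ[X]} {f : ℝ → ℂ} {s t : ℝ} (hst : s < t)
    (hf : ContinuousOn f (Icc s t)) (hr : ∀ x ∈ Icc s t, ∃ r : ℝ, T.eval (f x) = r)
    (hi : InjOn (fun x => T.eval (f x)) (Icc s t)) : IsSectionChain T f s t := by
  set u : ℝ → ℝ := fun x => (T.eval (f x)).re with hu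
  have hTu : ∀ x ∈ Icc s t, T.eval (f x) = u x := by
    intro x hx
    obtain ⟨r, h⟩ := hr x hx
    simp [hu, h]
  have huc : ContinuousOn u (Icc s t) :=
    Complex.continuous_re.comp_continuousOn (T.continuous.comp_continuousOn hf)
  have hui : InjOn u (Icc s t) := fun x hx y hy hxy => hi hx hy (by
    simp only [hTu x hx, hTu y hy, hxy])
  have hinv := continuousOn_invFunOn_image isCompact_Icc huc hui
  have hl := hui.leftInvOn_invFunOn
  have hs := left_mem_Icc.mpr hst.le
  have ht := right_mem_Icc.mpr hst.le
  have main : ∀ (α β : ℝ) (ε : ℂ), α < β → u '' Icc s t = Icc α β → ε ≠ 0 →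
      (∀ P : ℂ[X], ε * (P.eval (f (Function.invFunOn u (Icc s t) β)) -
        P.eval (f (Function.invFunOn u (Icc s t) α))) = P.eval (f t) - P.eval (f s)) →
      IsSectionChain T f s t := by
    intro α β ε hαβ him hε hP
    refine ⟨Unit, inferInstance, fun _ => α, fun _ => β,
      fun _ => f ∘ Function.invFunOn u (Icc s t), fun _ => ε, fun _ => hαβ, fun _ => ?_,
      fun _ x hx => ?_, fun i j hij => absurd (Subsingleton.elim i j) hij, fun _ => hε,
      fun P => by simpa using hP P⟩
    · rw [him] at hinv
      refine hf.comp hinv fun x hx => ?_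
      rw [← him] at hx
      exact Function.invFunOn_mem hx
    · rw [← him] at hx
      have h1 := Function.invFunOn_mem hx
      refine ⟨?_, _, h1, rfl⟩
      change T.eval (f _) = _
      rw [hTu _ h1, Function.invFunOn_eq hx]
  rcases huc.strictMonoOn_of_injOn_Icc' hst.le hui with h | h
  · refine main (u s) (u t) 1 (h hs ht hst) ?_ one_ne_zero fun P => ?_
    · refine Subset.antisymm ?_ (intermediate_value_Icc hst.le huc)
      rintro _ ⟨x, hx, rfl⟩
      exact ⟨h.monotoneOn hs hx hx.1, h.monotoneOn hx ht hx.2⟩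
    · rw [hl hs, hl ht, one_mul]
  · refine main (u t) (u s) (-1) (h hs ht hst) ?_ (by simp) fun P => ?_
    · refine Subset.antisymm ?_ (intermediate_value_Icc' hst.le huc)
      rintro _ ⟨x, hx, rfl⟩
      exact ⟨h.antitoneOn hx ht hx.2, h.antitoneOn hs hx hx.1⟩
    · rw [hl hs, hl ht]
      ring

/-- Since `f` is injective, the two pieces meet only at `f y`, so a section of one and a section of
the other can agree only at the parameter `T (f y)`. -/
lemma IsSectionChain.trans {T : ℂ[X]} {f : ℝ → ℂ} {a b x y z : ℝ} (hi : InjOn f (Icc a b))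
    (hax : a ≤ x) (hxy : x < y) (hyz : y < z) (hzb : z ≤ b) (h₁ : IsSectionChain T f x y)
    (h₂ : IsSectionChain T f y z) : IsSectionChain T f x z := by
  obtain ⟨ι, _, α, β, σ, ε, h1, h2, h3, h4, h5, h6⟩ := h₁
  obtain ⟨κ, _, α', β', σ', ε', h1', h2', h3', h4', h5', h6'⟩ := h₂
  have key : ∀ i j, {t | t ∈ Icc (α i) (β i) ∧ t ∈ Icc (α' j) (β' j) ∧ σ i t = σ' j t}.Finite := by
    intro i j
    refine (finite_singleton (T.eval (f y)).re).subset ?_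
    rintro t ⟨ht, ht', hσ⟩
    obtain ⟨hTt, p, hp, hpt⟩ := h3 i t ht
    obtain ⟨-, q, hq, hqt⟩ := h3' j t ht'
    have hpq : p = q := hi ⟨hax.trans hp.1, hp.2.trans (hyz.le.trans hzb)⟩
      ⟨hax.trans (hxy.le.trans hq.1), hq.2.trans hzb⟩ (by rw [hpt, hqt, hσ])
    have hpy : p = y := le_antisymm hp.2 (hpq ▸ hq.1)
    rw [← hpt, hpy] at hTt
    simp [hTt]
  refine ⟨ι ⊕ κ, inferInstance, Sum.elim α α', Sum.elim β β', Sum.elim σ σ', Sum.elim ε ε',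
    ?_, ?_, ?_, ?_, ?_, ?_⟩
  · rintro (i | i)
    exacts [h1 i, h1' i]
  · rintro (i | i)
    exacts [h2 i, h2' i]
  · rintro (i | i) t ht
    · exact ⟨(h3 i t ht).1, image_mono (Icc_subset_Icc_right hyz.le) (h3 i t ht).2⟩
    · exact ⟨(h3' i t ht).1, image_mono (Icc_subset_Icc_left hxy.le) (h3' i t ht).2⟩
  · rintro (i | i) (j | j) hij
    · exact h4 fun h => hij (congrArg _ h)
    · exact key i j
    · refine (key j i).subset ?_
      rintro t ⟨u1, u2, u3⟩
      exact ⟨u2, u1, u3.symm⟩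
    · exact h4' fun h => hij (congrArg _ h)
  · rintro (i | i)
    exacts [h5 i, h5' i]
  · intro P
    simp only [Fintype.sum_sum_type, Sum.elim_inl, Sum.elim_inr, h6 P, h6' P]
    ring

/-- `T` is injective along `f` on a short interval on either side of each parameter;
`interval_chain` assembles these pieces. -/
lemma isSectionChain_of_injOn {T : ℂ[X]} (hT : 0 < T.natDegree) {f : ℝ → ℂ} {a b : ℝ} (hab : a < b)
    (hf : ContinuousOn f (Icc a b)) (hi : InjOn f (Icc a b))
    (hr : ∀ t ∈ Icc a b, ∃ r : ℝ, T.eval (f t) = r) : IsSectionChain T f a b := by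
  refine interval_chain hab (fun x y z hax hxy hyz hzb => IsSectionChain.trans hi hax hxy hyz hzb)
    (fun x hax hxb => ?_) (fun x hax hxb => ?_)
  · have hsub : Icc x b ⊆ Icc a b := Icc_subset_Icc_left hax
    obtain ⟨η, hη, hb, H⟩ := exists_injOn_eval_right hT hxb (hf.mono hsub) (hi.mono hsub)
      fun t ht => hr t (hsub ht)
    refine ⟨η, hη, fun s t hs hst ht htb => ?_⟩
    have hsub' : Icc s t ⊆ Icc a b := Icc_subset_Icc (hax.trans hs) htb
    exact isSectionChain_of_injOn_eval hst (hf.mono hsub') (fun y hy => hr y (hsub' hy))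
      (H.mono (Icc_subset_Icc hs ht.le))
  · have hsub : Icc a x ⊆ Icc a b := Icc_subset_Icc_right hxb
    obtain ⟨η, hη, hb, H⟩ := exists_injOn_eval_left hT hax (hf.mono hsub) (hi.mono hsub)
      fun t ht => hr t (hsub ht)
    refine ⟨η, hη, fun s t hs hst ht hsa => ?_⟩
    have hsub' : Icc s t ⊆ Icc a b := Icc_subset_Icc hsa (ht.trans hxb)
    exact isSectionChain_of_injOn_eval hst (hf.mono hsub') (fun y hy => hr y (hsub' hy))
      (H.mono (Icc_subset_Icc hs.le ht))

/-- Two injective curves with the same distinct endpoints along which a polynomial is real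
have infinitely many common points: the real locus of a polynomial contains no cycle. -/
lemma infinite_inter_of_common_endpoints {T : ℂ[X]} (hT : 0 < T.natDegree) {f g : ℝ → ℂ}
    {a b c d : ℝ} (hab : a < b) (hcd : c < d)
    (hf : ContinuousOn f (Icc a b)) (hfi : InjOn f (Icc a b))
    (hfr : ∀ t ∈ Icc a b, ∃ r : ℝ, T.eval (f t) = r)
    (hg : ContinuousOn g (Icc c d)) (hgi : InjOn g (Icc c d))
    (hgr : ∀ t ∈ Icc c d, ∃ r : ℝ, T.eval (g t) = r)
    (h₀ : f a = g c) (h₁ : f b = g d) : (f '' Icc a b ∩ g '' Icc c d).Infinite := by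
  intro hfin
  obtain ⟨ι, _, α, β, σ, ε, h1, h2, h3, h4, h5, h6⟩ := isSectionChain_of_injOn hT hab hf hfi hfr
  obtain ⟨κ, _, α', β', σ', ε', h1', h2', h3', h4', h5', h6'⟩ :=
    isSectionChain_of_injOn hT hcd hg hgi hgr
  have hne : Nonempty ι := by
    by_contra h
    rw [not_nonempty_iff] at h
    -- Tested against the identity, an empty chain would force `f a = f b`.
    have := h6 X
    simp only [Finset.univ_eq_empty, Finset.sum_empty, eval_X] at this
    exact hab.ne (hfi (left_mem_Icc.mpr hab.le) (right_mem_Icc.mpr hab.le)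
      (sub_eq_zero.mp this.symm).symm)
  have key : ∀ i j, {t | t ∈ Icc (α i) (β i) ∧ t ∈ Icc (α' j) (β' j) ∧ σ i t = σ' j t}.Finite := by
    intro i j
    refine (hfin.image fun y => (T.eval y).re).subset ?_
    rintro t ⟨ht, ht', hσ⟩
    refine ⟨σ i t, ⟨(h3 i t ht).2, hσ ▸ (h3' j t ht').2⟩, ?_⟩
    simp [(h3 i t ht).1]
  -- The chain of `f` minus the chain of `g` has zero boundary because the endpoints agree.
  refine sections_independent hT (ι := ι ⊕ κ) (Sum.elim α α') (Sum.elim β β') ?_ (Sum.elim σ σ')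
    ?_ ?_ ?_ (Sum.elim ε (-ε')) ?_ ?_
  · rintro (i | i)
    exacts [h1 i, h1' i]
  · rintro (i | i)
    exacts [h2 i, h2' i]
  · rintro (i | i) t ht
    exacts [(h3 i t ht).1, (h3' i t ht).1]
  · rintro (i | i) (j | j) hij
    · exact h4 fun h => hij (congrArg _ h)
    · exact key i j
    · refine (key j i).subset ?_
      rintro t ⟨u1, u2, u3⟩
      exact ⟨u2, u1, u3.symm⟩
    · exact h4' fun h => hij (congrArg _ h)
  · rintro (i | i)
    exacts [h5 i, neg_ne_zero.mpr (h5' i)]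
  · intro P
    simp only [Fintype.sum_sum_type, Sum.elim_inl, Sum.elim_inr, h6 P, Pi.neg_apply, neg_mul,
      Finset.sum_neg_distrib, h6' P, h₀, h₁]
    ring

/-! ### Existence of a finite decomposition into arcs. -/

/-- The set `S` is a finite union of Jordan arcs with finite pairwise intersections. -/
def IsFiniteArcUnion (S : Set ℂ) : Prop :=
  ∃ (ι : Type) (_ : Fintype ι) (K : ι → Set ℂ) (p q : ι → ℂ),
    (∀ i, IsJordanArc (K i) (p i) (q i)) ∧ (⋃ i, K i) = S ∧
    Pairwise fun i j => (K i ∩ K j).Finite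

/-- The inverse image of the real interval `[s, t]`. -/
def intervalPreimage (T : ℂ[X]) (s t : ℝ) : Set ℂ :=
  {z : ℂ | ∃ r ∈ Icc s t, T.eval z = (r : ℂ)}

lemma finite_fiber {T : ℂ[X]} (hT : 0 < T.natDegree) (c : ℂ) : {z | T.eval z = c}.Finite := by
  refine (T - C c).roots.toFinset.finite_toSet.subset fun z hz => ?_
  have := sub_C_ne_zero_of_natDegree_pos hT c
  simpa [this, sub_eq_zero] using hz

/-- Polynomials are closed maps: nearby fibers are contained in a neighbourhood of a fiber. -/
lemma exists_fiber_subset {T : ℂ[X]} (hT : 0 < T.natDegree) (c : ℂ) {O : Set ℂ} (hO : IsOpen O)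
    (h : ∀ z, T.eval z = c → z ∈ O) : ∃ η > 0, ∀ y, ‖T.eval y - c‖ < η → y ∈ O := by
  have hlim : Tendsto (fun z : ℂ => ‖T.eval z‖) (cocompact ℂ) atTop :=
    T.tendsto_norm_atTop (natDegree_pos_iff_degree_pos.mp hT) tendsto_norm_cocompact_atTop
  obtain ⟨K, hK, hKs⟩ := mem_cocompact.mp (hlim.eventually_gt_atTop (1 + ‖c‖))
  have hc : IsCompact (K \ O) := hK.diff hO
  have hcont : Continuous fun y => ‖T.eval y - c‖ := (T.continuous.sub continuous_const).norm
  have hout : ∀ y, ‖T.eval y - c‖ < 1 → y ∉ O → y ∈ K \ O := by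
    intro y hy hyO
    refine ⟨?_, hyO⟩
    by_contra hyK
    have h1 : 1 + ‖c‖ < ‖T.eval y‖ := hKs hyK
    have h2 := norm_sub_norm_le (T.eval y) c
    linarith
  rcases (K \ O).eq_empty_or_nonempty with he | hne
  · refine ⟨1, one_pos, fun y hy => ?_⟩
    by_contra hyO
    have := hout y hy hyO
    rw [he] at this
    exact this
  · obtain ⟨x, hx, hmin⟩ := hc.exists_isMinOn hne hcont.continuousOn
    have hpos : 0 < ‖T.eval x - c‖ := norm_pos_iff.mpr fun h0 => hx.2 (h x (sub_eq_zero.mp h0))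
    refine ⟨min 1 ‖T.eval x - c‖, lt_min one_pos hpos, fun y hy => ?_⟩
    by_contra hyO
    have h1 : ‖T.eval x - c‖ ≤ ‖T.eval y - c‖ :=
      hmin (hout y (hy.trans_le (min_le_left _ _)) hyO)
    exact absurd (hy.trans_le (min_le_right _ _)) (not_lt.mpr h1)

/-- Near the fiber over `c`, the points with values in `[s, t]` lie on the rays `ζ * (x - c) ^ (1 /
m)` with `ζ ^ m = 1`, in charts centred at the points of that fiber. The charts lie in disjoint open
sets, so rays from different centres never meet, and rays from one centre meet at most there. The
bound `η` keeps the rays inside the charts and keeps the nearby fibers inside the union of the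
charts. -/
lemma isFiniteArcUnion_right {T : ℂ[X]} (hT : 0 < T.natDegree) (c : ℝ) :
    ∃ η > 0, ∀ s t, c ≤ s → s < t → t < c + η → IsFiniteArcUnion (intervalPreimage T s t) := by
  set Z : Set ℂ := {z | T.eval z = c}
  have hZf : Z.Finite := finite_fiber hT c
  obtain ⟨U, hU, hUd⟩ := hZf.t2_separation
  choose Φ hΦ using fun z => exists_powerChart hT z ((hU z).2.mem_nhds (hU z).1)
  have hm0 (z : ℂ) : valueMultiplicity T z ≠ 0 := (valueMultiplicity_pos hT z).ne'
  obtain ⟨η₁, hη₁, H₁⟩ := exists_fiber_subset hT c (O := ⋃ z ∈ Z, (Φ z).chart.source)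
    (isOpen_biUnion fun z _ => (Φ z).chart.open_source)
    (fun z hz => mem_biUnion hz (Φ z).mem_source)
  obtain ⟨η, hη, hηη₁, hηρ⟩ : ∃ η > 0, η < η₁ ∧
      ∀ z ∈ Z, η < (Φ z).radius ^ valueMultiplicity T z := by
    have h : ∀ᶠ η in 𝓝[>] (0 : ℝ), 0 < η ∧ η < η₁ ∧
        ∀ z ∈ Z, η < (Φ z).radius ^ valueMultiplicity T z := by
      refine (eventually_mem_nhdsWithin).and (Eventually.and ?_ ?_)
      · exact nhdsWithin_le_nhds (eventually_lt_nhds hη₁)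
      · rw [eventually_all_finite hZf]
        exact fun z _ => nhdsWithin_le_nhds (eventually_lt_nhds (pow_pos (Φ z).radius_pos _))
    exact h.exists
  refine ⟨η, hη, fun s t hcs hst ht => ?_⟩
  let f : ∀ z : ℂ, ℂ → ℝ → ℂ := fun z ζ x =>
    (Φ z).chart.symm (ζ * ((x - c) ^ ((valueMultiplicity T z : ℝ)⁻¹) : ℝ))
  have hpow (z : ℂ) {x : ℝ} (hx : x ∈ Icc s t) :
      (((x - c) ^ ((valueMultiplicity T z : ℝ)⁻¹) : ℝ)) ^ valueMultiplicity T z = x - c :=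
    Real.rpow_inv_natCast_pow (by linarith [hx.1]) (hm0 z)
  have hmem {z ζ : ℂ} (hz : z ∈ Z) (hζ : ζ ^ valueMultiplicity T z = 1) {x : ℝ}
      (hx : x ∈ Icc s t) :
      ζ * ((x - c) ^ ((valueMultiplicity T z : ℝ)⁻¹) : ℝ) ∈ (Φ z).chart.target := by
    rw [(Φ z).target_eq, mem_ball_zero_iff]
    refine lt_of_pow_lt_pow_left₀ (valueMultiplicity T z) (Φ z).radius_pos.le ?_
    rw [← norm_pow, mul_pow, hζ, one_mul, ← Complex.ofReal_pow, hpow z hx, Complex.norm_real,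
      Real.norm_eq_abs, abs_of_nonneg (by linarith [hx.1])]
    linarith [hx.2, hηρ z hz]
  have heval {z ζ : ℂ} (hz : z ∈ Z) (hζ : ζ ^ valueMultiplicity T z = 1) {x : ℝ}
      (hx : x ∈ Icc s t) : T.eval (f z ζ x) = x := by
    rw [(Φ z).eval_eq _ ((Φ z).chart.map_target (hmem hz hζ hx)),
      (Φ z).chart.right_inv (hmem hz hζ hx), mul_pow, hζ, one_mul, ← Complex.ofReal_pow, hpow z hx,
      show T.eval z = c from hz]
    push_cast
    ring
  have hcont {z ζ : ℂ} (hz : z ∈ Z) (hζ : ζ ^ valueMultiplicity T z = 1) :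
      ContinuousOn (f z ζ) (Icc s t) := by
    refine (Φ z).chart.continuousOn_symm.comp (Continuous.continuousOn ?_)
      fun x hx => hmem hz hζ hx
    refine continuous_const.mul (Complex.continuous_ofReal.comp ?_)
    exact (Real.continuous_rpow_const (by positivity)).comp (continuous_id.sub continuous_const)
  have hZfin : Finite Z := hZf
  have hrfin (z : Z) : Finite {ζ : ℂ // ζ ^ valueMultiplicity T z.1 = 1} := finite_pow_eq (hm0 z) 1
  refine ⟨Σ z : Z, {ζ : ℂ // ζ ^ valueMultiplicity T z.1 = 1}, Fintype.ofFinite _,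
    fun i => f i.1 i.2 '' Icc s t, fun i => f i.1 i.2 s, fun i => f i.1 i.2 t, ?_, ?_, ?_⟩
  · rintro ⟨⟨z, hz⟩, ζ, hζ⟩
    refine isJordanArc_image hst (hcont hz hζ) fun x hx y hy hxy => ?_
    have := congrArg (fun w => T.eval w) hxy
    simpa [heval hz hζ hx, heval hz hζ hy] using this
  · ext y
    simp only [mem_iUnion]
    constructor
    · rintro ⟨⟨⟨z, hz⟩, ζ, hζ⟩, x, hx, rfl⟩
      exact ⟨x, hx, heval hz hζ hx⟩
    · rintro ⟨x, hx, hxy⟩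
      have h1 : ‖T.eval y - c‖ < η₁ := by
        rw [hxy, ← Complex.ofReal_sub, Complex.norm_real, Real.norm_eq_abs,
          abs_of_nonneg (by linarith [hx.1])]
        linarith [hx.2]
      obtain ⟨z, hz, hyz⟩ := mem_iUnion₂.mp (H₁ y h1)
      have hw : (Φ z).chart y ^ valueMultiplicity T z = ((x - c : ℝ) : ℂ) := by
        have := (Φ z).eval_eq y hyz
        rw [hxy, show T.eval z = c from hz] at this
        push_cast
        linear_combination -this
      set r : ℝ := (x - c) ^ ((valueMultiplicity T z : ℝ)⁻¹) with hr
      rw [← hpow z hx, ← hr, Complex.ofReal_pow] at hw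
      by_cases hr0 : r = 0
      -- At the centre of the star all rays agree; the root 1 is an arbitrary choice.
      · refine ⟨⟨⟨z, hz⟩, 1, one_pow _⟩, x, hx, ?_⟩
        rw [hr0, Complex.ofReal_zero, zero_pow (hm0 z), pow_eq_zero_iff (hm0 z)] at hw
        simp only [f, ← hr, hr0, Complex.ofReal_zero, mul_zero]
        rw [← hw, (Φ z).chart.left_inv hyz]
      · have hr0' : (r : ℂ) ≠ 0 := Complex.ofReal_ne_zero.mpr hr0
        refine ⟨⟨⟨z, hz⟩, (Φ z).chart y / r, ?_⟩, x, hx, ?_⟩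
        · rw [div_pow, hw, div_self (pow_ne_zero _ hr0')]
        · simp only [f, ← hr, div_mul_cancel₀ _ hr0']
          exact (Φ z).chart.left_inv hyz
  · rintro ⟨⟨z, hz⟩, ζ, hζ⟩ ⟨⟨z', hz'⟩, ζ', hζ'⟩ hne
    refine (finite_singleton z).subset ?_
    rintro _ ⟨⟨x, hx, rfl⟩, x', hx', hxx⟩
    have hxx' : x = x' := by
      have := congrArg (fun w => T.eval w) hxx
      simp only [heval hz hζ hx, heval hz' hζ' hx', Complex.ofReal_inj] at this
      exact this.symm
    subst hxx'
    by_cases hzz : z = z'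
    · subst hzz
      have h1 := (Φ z).chart.symm.injOn (hmem hz hζ hx) (hmem hz hζ' hx) hxx.symm
      by_cases hr0 : (((x - c) ^ ((valueMultiplicity T z : ℝ)⁻¹) : ℝ) : ℂ) = 0
      · simp only [f, hr0, mul_zero, mem_singleton_iff]
        rw [← (Φ z).map_center, (Φ z).chart.left_inv (Φ z).mem_source]
      · have := mul_right_cancel₀ hr0 h1
        subst this
        exact absurd rfl hne
    · have h1 := hΦ z ((Φ z).chart.map_target (hmem hz hζ hx))
      have h2 := hΦ z' ((Φ z').chart.map_target (hmem hz' hζ' hx))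
      change f z ζ x ∈ U z at h1
      change f z' ζ' x ∈ U z' at h2
      simp only at hxx
      rw [hxx] at h2
      exact absurd h2 (disjoint_left.mp (hUd hz hz' hzz) h1)

lemma intervalPreimage_neg (T : ℂ[X]) (s t : ℝ) :
    intervalPreimage (-T) (-t) (-s) = intervalPreimage T s t := by
  ext z
  constructor
  · rintro ⟨r, hr, h⟩
    refine ⟨-r, ⟨by linarith [hr.2], by linarith [hr.1]⟩, ?_⟩
    rw [eval_neg] at h
    rw [Complex.ofReal_neg, ← h, neg_neg]
  · rintro ⟨r, hr, h⟩
    exact ⟨-r, ⟨by linarith [hr.2], by linarith [hr.1]⟩, by simp [h]⟩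

lemma isFiniteArcUnion_left {T : ℂ[X]} (hT : 0 < T.natDegree) (c : ℝ) :
    ∃ η > 0, ∀ s t, c - η < s → s < t → t ≤ c → IsFiniteArcUnion (intervalPreimage T s t) := by
  obtain ⟨η, hη, H⟩ := isFiniteArcUnion_right (T := -T) (by rwa [natDegree_neg]) (-c)
  refine ⟨η, hη, fun s t hs hst ht => ?_⟩
  rw [← intervalPreimage_neg]
  exact H _ _ (by linarith) (by linarith) (by linarith)

/-- An arc over `[x, y]` and one over `[y, z]` can meet only in the finite fiber over `y`. -/
lemma IsFiniteArcUnion.trans {T : ℂ[X]} (hT : 0 < T.natDegree) {x y z : ℝ} (hxy : x < y)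
    (hyz : y < z) (h₁ : IsFiniteArcUnion (intervalPreimage T x y))
    (h₂ : IsFiniteArcUnion (intervalPreimage T y z)) :
    IsFiniteArcUnion (intervalPreimage T x z) := by
  obtain ⟨ι, _, K, p, q, h1, h2, h3⟩ := h₁
  obtain ⟨κ, _, K', p', q', h1', h2', h3'⟩ := h₂
  have key (i j) : (K i ∩ K' j).Finite := by
    refine (finite_fiber hT y).subset ?_
    rintro w ⟨hw, hw'⟩
    have u1 : w ∈ intervalPreimage T x y := h2 ▸ mem_iUnion_of_mem i hw
    have u2 : w ∈ intervalPreimage T y z := h2' ▸ mem_iUnion_of_mem j hw'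
    obtain ⟨r, hr, hrw⟩ := u1
    obtain ⟨r', hr', hrw'⟩ := u2
    have : r = r' := Complex.ofReal_injective (hrw.symm.trans hrw')
    have : r = y := le_antisymm hr.2 (this ▸ hr'.1)
    exact this ▸ hrw
  refine ⟨ι ⊕ κ, inferInstance, Sum.elim K K', Sum.elim p p', Sum.elim q q', ?_, ?_, ?_⟩
  · rintro (i | i)
    exacts [h1 i, h1' i]
  · rw [iUnion_sum]
    simp only [Sum.elim_inl, Sum.elim_inr, h2, h2']
    ext w
    constructor
    · rintro (⟨r, hr, h⟩ | ⟨r, hr, h⟩)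
      · exact ⟨r, ⟨hr.1, hr.2.trans hyz.le⟩, h⟩
      · exact ⟨r, ⟨hxy.le.trans hr.1, hr.2⟩, h⟩
    · rintro ⟨r, hr, h⟩
      rcases le_total r y with h' | h'
      · exact Or.inl ⟨r, ⟨hr.1, h'⟩, h⟩
      · exact Or.inr ⟨r, ⟨h', hr.2⟩, h⟩
  · rintro (i | i) (j | j) hij
    · exact h3 fun h => hij (congrArg _ h)
    · exact key i j
    · rw [inter_comm]
      exact key j i
    · exact h3' fun h => hij (congrArg _ h)

/-- The inverse image of `[-1, 1]` under a nonconstant polynomial is a finite union of arcs. -/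
lemma isFiniteArcUnion_inverseImage {T : ℂ[X]} (hT : 0 < T.natDegree) :
    IsFiniteArcUnion (inverseImage T) := by
  refine interval_chain (R := fun s t => IsFiniteArcUnion (intervalPreimage T s t))
    (by norm_num : (-1 : ℝ) < 1) (fun x y z _ hxy hyz _ => IsFiniteArcUnion.trans hT hxy hyz)
    (fun x _ _ => ?_) (fun x _ _ => ?_)
  · obtain ⟨η, hη, H⟩ := isFiniteArcUnion_right hT x
    exact ⟨η, hη, fun s t h1 h2 h3 _ => H s t h1 h2 h3⟩
  · obtain ⟨η, hη, H⟩ := isFiniteArcUnion_left hT x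
    exact ⟨η, hη, fun s t h1 h2 h3 _ => H s t h1 h2 h3⟩

/-! ### Merging arcs, and distinctness of endpoints in a minimal decomposition. -/

lemma exists_consistsOfJordanArcs {S : Set ℂ} {ι : Type*} [Fintype ι] {K : ι → Set ℂ} {p q : ι → ℂ}
    (h₁ : ∀ i, IsJordanArc (K i) (p i) (q i)) (h₂ : (⋃ i, K i) = S)
    (h₃ : Pairwise fun i j => (K i ∩ K j).Finite) :
    ∃ b, ConsistsOfJordanArcs S (Fintype.card ι) b := by
  let e₀ : Fin (Fintype.card ι) ≃ ι := (Fintype.equivFin ι).symm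
  let e : Fin (Fintype.card ι) ⊕ Fin (Fintype.card ι) ≃ Fin (2 * Fintype.card ι) :=
    finSumFinEquiv.trans (finCongr (two_mul _).symm)
  refine ⟨fun i => Sum.elim (p ∘ e₀) (q ∘ e₀) (e.symm i), K ∘ e₀, e, fun j => ?_, ?_, ?_⟩
  · simpa using h₁ (e₀ j)
  · rw [← h₂]
    exact e₀.surjective.iUnion_comp K
  · exact fun i j hij => h₃ (e₀.injective.ne hij)

/-- Two Jordan arcs with a common endpoint as their only common point form a Jordan arc. -/
lemma IsJordanArc.union {K L : Set ℂ} {p q r : ℂ} (hK : IsJordanArc K p q) (hL : IsJordanArc L p r)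
    (h : K ∩ L ⊆ {p}) : IsJordanArc (K ∪ L) q r := by
  obtain ⟨f, hf, hfi, hf0, hf1, rfl⟩ := hK.exists_param
  obtain ⟨g, hg, hgi, hg0, hg1, rfl⟩ := hL.exists_param
  -- The first arc is traversed backwards on `[-1, 0]`, so that both pieces take the value `p` at 0.
  let u : ℝ → ℂ := fun x => if x ≤ 0 then f (-x) else g x
  have hu : Continuous u := Continuous.if_le (hf.comp continuous_neg) hg continuous_id
    continuous_const (by rintro x rfl; simp [hf0, hg0])
  have hneg {x : ℝ} (hx : x ≤ 0) : u x = f (-x) := if_pos hx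
  have hpos {x : ℝ} (hx : 0 < x) : u x = g x := if_neg hx.not_ge
  have hcross {x y : ℝ} (hx : x ∈ Icc (-1) 1) (hy : y ∈ Icc (-1) 1) (hx0 : x ≤ 0) (hy0 : 0 < y) :
      u x ≠ u y := by
    rw [hneg hx0, hpos hy0]
    intro hxy
    have hy' : y ∈ Icc (0 : ℝ) 1 := ⟨hy0.le, hy.2⟩
    have : g y = p := h ⟨⟨-x, ⟨by linarith, by linarith [hx.1]⟩, hxy⟩, y, hy', rfl⟩
    exact hy0.ne' (hgi hy' ⟨le_rfl, zero_le_one⟩ (this.trans hg0.symm))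
  have hi : InjOn u (Icc (-1) 1) := by
    intro x hx y hy hxy
    rcases le_or_gt x 0 with h1 | h1 <;> rcases le_or_gt y 0 with h2 | h2
    · rw [hneg h1, hneg h2] at hxy
      exact neg_injective (hfi ⟨by linarith, by linarith [hx.1]⟩
        ⟨by linarith, by linarith [hy.1]⟩ hxy)
    · exact absurd hxy (hcross hx hy h1 h2)
    · exact absurd hxy.symm (hcross hy hx h2 h1)
    · rw [hpos h1, hpos h2] at hxy
      exact hgi ⟨h1.le, hx.2⟩ ⟨h2.le, hy.2⟩ hxy
  have him : u '' Icc (-1) 1 = f '' Icc 0 1 ∪ g '' Icc 0 1 := by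
    ext w
    constructor
    · rintro ⟨x, hx, rfl⟩
      rcases le_or_gt x 0 with h1 | h1
      · exact Or.inl ⟨-x, ⟨by linarith, by linarith [hx.1]⟩, (hneg h1).symm⟩
      · exact Or.inr ⟨x, ⟨h1.le, hx.2⟩, (hpos h1).symm⟩
    · rintro (⟨x, hx, rfl⟩ | ⟨x, hx, rfl⟩)
      · exact ⟨-x, ⟨by linarith [hx.2], by linarith [hx.1]⟩,
          by rw [hneg (by linarith [hx.1]), neg_neg]⟩
      · rcases hx.1.eq_or_lt with h1 | h1
        · exact ⟨0, ⟨by norm_num, by norm_num⟩, by rw [hneg le_rfl, ← h1, neg_zero, hf0, hg0]⟩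
        · exact ⟨x, ⟨by linarith, hx.2⟩, hpos h1⟩
  have := isJordanArc_image (by norm_num : (-1 : ℝ) < 1) hu.continuousOn hi
  rwa [him, hneg (by norm_num), neg_neg, hf1, hpos one_pos, hg1] at this

/-- Distinct arcs of a decomposition of the inverse image that share an endpoint meet only there. -/
lemma inter_subset_singleton_of_common_endpoint {T : ℂ[X]} (hT : 0 < T.natDegree) {K L : Set ℂ}
    {p q r : ℂ} (hK : IsJordanArc K p q) (hL : IsJordanArc L p r) (hKS : K ⊆ inverseImage T)
    (hLS : L ⊆ inverseImage T) (hfin : (K ∩ L).Finite) : K ∩ L ⊆ {p} := by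
  rintro w ⟨hwK, hwL⟩
  by_contra hwp
  obtain ⟨f, hf, hfi, hf0, -, rfl⟩ := hK.exists_param
  obtain ⟨g, hg, hgi, hg0, -, rfl⟩ := hL.exists_param
  obtain ⟨s, hs, hsw⟩ := hwK
  obtain ⟨t, ht, htw⟩ := hwL
  have hs0 : 0 < s := lt_of_le_of_ne hs.1 (by rintro rfl; exact hwp (hsw.symm.trans hf0))
  have ht0 : 0 < t := lt_of_le_of_ne ht.1 (by rintro rfl; exact hwp (htw.symm.trans hg0))
  -- A second common point `w` would give two subarcs from `p` to `w` with finite intersection, that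
  -- is, a cycle.
  have hs' : Icc 0 s ⊆ Icc (0 : ℝ) 1 := Icc_subset_Icc_right hs.2
  have ht' : Icc 0 t ⊆ Icc (0 : ℝ) 1 := Icc_subset_Icc_right ht.2
  refine infinite_inter_of_common_endpoints hT hs0 ht0 hf.continuousOn (hfi.mono hs') ?_
    hg.continuousOn (hgi.mono ht') ?_ (hf0.trans hg0.symm) (hsw.trans htw.symm)
    (hfin.subset (inter_subset_inter (image_mono hs') (image_mono ht')))
  · intro x hx
    obtain ⟨r, -, h⟩ := hKS ⟨x, hs' hx, rfl⟩
    exact ⟨r, h⟩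
  · intro x hx
    obtain ⟨r, -, h⟩ := hLS ⟨x, ht' hx, rfl⟩
    exact ⟨r, h⟩

/-- In a decomposition of the inverse image into as few arcs as possible the endpoints are
pairwise distinct. -/
lemma endpoints_injective_of_minimal {T : ℂ[X]} (hT : 0 < T.natDegree) {l : ℕ}
    {a : Fin (2 * l) → ℂ} (h : ConsistsOfJordanArcs (inverseImage T) l a)
    (hmin : ∀ k < l, ∀ b : Fin (2 * k) → ℂ, ¬ ConsistsOfJordanArcs (inverseImage T) k b) :
    Function.Injective a := by
  classical
  obtain ⟨K, e, h1, h2, h3⟩ := h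
  have hsub (j) : K j ⊆ inverseImage T := h2 ▸ subset_iUnion K j
  let idx : Fin l ⊕ Fin l → Fin l := Sum.elim id id
  -- Each `x` is an end of the arc `K (idx x)`, and `x.swap` is its other end; this treats all cases
  -- of a shared endpoint at once.
  have harc (x : Fin l ⊕ Fin l) : IsJordanArc (K (idx x)) (a (e x)) (a (e x.swap)) := by
    rcases x with j | j
    exacts [h1 j, (h1 j).symm]
  have hidx {x y : Fin l ⊕ Fin l} (hxy : idx x = idx y) (hne : x ≠ y) : y = x.swap := by
    rcases x with x | x <;> rcases y with y | y <;> simp_all [idx]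
  suffices H : ∀ x y, a (e x) = a (e y) → x = y by
    intro i i' hii
    have := H (e.symm i) (e.symm i') (by simpa using hii)
    exact e.symm.injective this
  intro x y hxy
  by_contra hne
  by_cases hj : idx x = idx y
  · rw [hidx hj hne] at hxy
    exact (harc x).ne hxy
  · have hx := harc x
    have hy := harc y
    rw [← hxy] at hy
    have hinter := inter_subset_singleton_of_common_endpoint hT hx hy (hsub _) (hsub _) (h3 hj)
    have hun := hx.union hy hinter
    set j := idx x
    set j' := idx y
    -- Arc `j` is replaced by the merged arc and the index `j'` is dropped, which leaves one arc
    -- fewer.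
    let K' : {i // i ≠ j'} → Set ℂ := fun i => if i.1 = j then K j ∪ K j' else K i
    let p' : {i // i ≠ j'} → ℂ := fun i => if i.1 = j then a (e x.swap) else a (e (Sum.inl i))
    let q' : {i // i ≠ j'} → ℂ := fun i => if i.1 = j then a (e y.swap) else a (e (Sum.inr i))
    have h1' (i) : IsJordanArc (K' i) (p' i) (q' i) := by
      by_cases hi : i.1 = j
      · simp only [K', p', q', if_pos hi]
        exact hun
      · simp only [K', p', q', if_neg hi]
        exact h1 i
    have h2' : (⋃ i, K' i) = inverseImage T := by
      rw [← h2]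
      ext w
      simp only [mem_iUnion]
      constructor
      · rintro ⟨i, hi⟩
        by_cases hij : i.1 = j
        · simp only [K', if_pos hij] at hi
          rcases hi with hi | hi
          exacts [⟨_, hi⟩, ⟨_, hi⟩]
        · simp only [K', if_neg hij] at hi
          exact ⟨_, hi⟩
      · rintro ⟨i, hi⟩
        by_cases hij : i = j ∨ i = j'
        · refine ⟨⟨j, hj⟩, ?_⟩
          simp only [K', if_true]
          rcases hij with rfl | rfl
          exacts [Or.inl hi, Or.inr hi]
        · push Not at hij
          refine ⟨⟨i, hij.2⟩, ?_⟩
          simpa only [K', if_neg hij.1] using hi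
    have h3' : Pairwise fun i j => (K' i ∩ K' j).Finite := by
      intro i i' hii
      have hii' : i.1 ≠ i'.1 := fun h => hii (Subtype.ext h)
      simp only [K']
      by_cases hi : i.1 = j <;> by_cases hi' : i'.1 = j
      · exact absurd (hi.trans hi'.symm) hii'
      · rw [if_pos hi, if_neg hi', union_inter_distrib_right]
        exact (h3 (Ne.symm hi')).union (h3 i'.2.symm)
      · rw [if_neg hi, if_pos hi', inter_union_distrib_left]
        exact (h3 hi).union (h3 i.2)
      · rw [if_neg hi, if_neg hi']
        exact h3 hii'
    obtain ⟨b, hb⟩ := exists_consistsOfJordanArcs h1' h2' h3'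
    refine hmin _ ?_ b hb
    rw [Fintype.card_subtype_compl, Fintype.card_fin, Fintype.card_subtype_eq]
    have := j.pos
    omega

/-! ### Counting branches at a point, modulo 2. -/

lemma ncard_pow_eq {m : ℕ} (hm : m ≠ 0) {a : ℂ} (ha : a ≠ 0) : {ζ : ℂ | ζ ^ m = a}.ncard = m := by
  classical
  have h1 : {ζ : ℂ | ζ ^ m = a} = ((nthRoots m a).toFinset : Set ℂ) := by
    ext ζ
    simp [mem_nthRoots (Nat.pos_of_ne_zero hm)]
  have h2 : (nthRoots m a).Nodup := nodup_roots (separable_X_pow_sub_C a (by exact_mod_cast hm) ha)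
  rw [h1, ncard_coe_finset, Multiset.toFinset_card_of_nodup h2, nthRoots,
    IsAlgClosed.card_roots_eq_natDegree, natDegree_X_pow_sub_C]

/-- The directions in which the inverse image of `[-1, 1]` leaves `z`, read in a power chart. -/
def directions (T : ℂ[X]) (z : ℂ) : Set ℂ :=
  {ζ | (ζ ^ valueMultiplicity T z = 1 ∧ (T.eval z).re < 1) ∨
    (ζ ^ valueMultiplicity T z = -1 ∧ -1 < (T.eval z).re)}

lemma norm_eq_one_of_mem_directions {T : ℂ[X]} (hT : 0 < T.natDegree) {z ζ : ℂ}
    (h : ζ ∈ directions T z) : ‖ζ‖ = 1 := by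
  have hm := (valueMultiplicity_pos hT z).ne'
  have h1 : ‖ζ‖ ^ valueMultiplicity T z = 1 := by
    rcases h with h | h <;> simp [← norm_pow, h.1]
  exact (pow_eq_one_iff_of_nonneg (norm_nonneg _) hm).mp h1

lemma rootMultiplicity_sq_sub_one {T : ℂ[X]} (hT : 0 < T.natDegree) (z : ℂ) :
    (T ^ 2 - 1).rootMultiplicity z =
      (T - C 1).rootMultiplicity z + (T - C (-1)).rootMultiplicity z := by
  rw [← rootMultiplicity_mul (mul_ne_zero (sub_C_ne_zero_of_natDegree_pos hT _)
    (sub_C_ne_zero_of_natDegree_pos hT _))]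
  congr 1
  simp only [map_neg, map_one]
  ring

lemma rootMultiplicity_sub_C_eq_zero {T : ℂ[X]} {z c : ℂ} (h : T.eval z ≠ c) :
    (T - C c).rootMultiplicity z = 0 :=
  rootMultiplicity_eq_zero (by simpa [IsRoot, sub_eq_zero] using h)

/-- At a point of the inverse image, the number of branches has the parity of the multiplicity
of the point as a zero of `T ^ 2 - 1`. -/
lemma odd_ncard_directions {T : ℂ[X]} (hT : 0 < T.natDegree) {z : ℂ} (hz : z ∈ inverseImage T) :
    Odd (directions T z).ncard ↔ Odd ((T ^ 2 - 1).rootMultiplicity z) := by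
  obtain ⟨t, ht, htz⟩ := hz
  have hm := (valueMultiplicity_pos hT z).ne'
  rw [rootMultiplicity_sq_sub_one hT]
  have hre : (T.eval z).re = t := by simp [htz]
  rcases ht.2.eq_or_lt with h1 | h1
  · subst h1
    have h2 : directions T z = {ζ | ζ ^ valueMultiplicity T z = -1} := by
      ext ζ
      simp only [directions, hre, mem_ofPred_eq]
      norm_num
    have hz1 : T.eval z = 1 := by simp [htz]
    rw [h2, ncard_pow_eq hm (by simp), rootMultiplicity_sub_C_eq_zero (c := -1)
      (by rw [hz1]; norm_num), add_zero, valueMultiplicity, hz1]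
  rcases ht.1.eq_or_lt with h2 | h2
  · subst h2
    have h2 : directions T z = {ζ | ζ ^ valueMultiplicity T z = 1} := by
      ext ζ
      simp only [directions, hre, mem_ofPred_eq]
      norm_num
    have hz1 : T.eval z = -1 := by simp [htz]
    rw [h2, ncard_pow_eq hm (by simp), rootMultiplicity_sub_C_eq_zero (c := 1)
      (by rw [hz1]; norm_num), zero_add, valueMultiplicity, hz1]
  -- At an interior value there are `2m` branches, an even number, while `T ^ 2 - 1` does not vanish
  -- at `z`.
  · have h3 : directions T z = {ζ | ζ ^ valueMultiplicity T z = 1} ∪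
        {ζ | ζ ^ valueMultiplicity T z = -1} := by
      ext ζ
      simp only [directions, hre, mem_ofPred_eq, mem_union, h1, h2, and_true]
    have hdisj : Disjoint {ζ : ℂ | ζ ^ valueMultiplicity T z = 1}
        {ζ | ζ ^ valueMultiplicity T z = -1} := by
      rw [Set.disjoint_left]
      intro ζ (ha : ζ ^ _ = 1) (hb : ζ ^ _ = -1)
      rw [ha] at hb
      norm_num at hb
    rw [h3, ncard_union_eq hdisj (finite_pow_eq hm 1) (finite_pow_eq hm (-1)),
      ncard_pow_eq hm one_ne_zero, ncard_pow_eq hm (by simp),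
      rootMultiplicity_sub_C_eq_zero (c := 1), rootMultiplicity_sub_C_eq_zero (c := -1)]
    · simp only [add_zero, Nat.odd_add]
      grind
    · rw [htz]
      intro h
      have := congrArg Complex.re h
      simp at this
      linarith
    · rw [htz]
      intro h
      have := congrArg Complex.re h
      simp at this
      linarith

/-! ### Germs of branches as filters. -/

namespace PowerChart

variable {T : ℂ[X]} {z : ℂ} (Φ : PowerChart T z)

/-- The germ at `z` of the ray of direction `ζ` in a power chart. -/
noncomputable def rayGerm (ζ : ℂ) : Filter ℂ :=
  map (fun x : ℝ => Φ.chart.symm (ζ * x)) (𝓝[>] 0)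

instance (ζ : ℂ) : (Φ.rayGerm ζ).NeBot := map_neBot

lemma eventually_mem_target (ζ : ℂ) : ∀ᶠ x : ℝ in 𝓝 0, ζ * x ∈ Φ.chart.target := by
  have hc : ContinuousAt (fun x : ℝ => ζ * (x : ℂ)) 0 := by fun_prop
  refine hc.eventually_mem (Φ.chart.open_target.mem_nhds ?_)
  simp [Φ.target_eq, Φ.radius_pos]

lemma symm_zero : Φ.chart.symm 0 = z := by
  rw [← Φ.map_center, Φ.chart.left_inv Φ.mem_source]

/-- Every direction is realized by an actual branch: the strict inequality in `directions` leaves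
room for `T` to move a little along the ray without leaving `[-1, 1]`. -/
lemma rayGerm_le (hT : 0 < T.natDegree) (hz : z ∈ inverseImage T) {ζ : ℂ}
    (hζ : ζ ∈ directions T z) : Φ.rayGerm ζ ≤ 𝓝[inverseImage T \ {z}] z := by
  obtain ⟨t, ht, htz⟩ := hz
  have hre : (T.eval z).re = t := by simp [htz]
  have hm := (valueMultiplicity_pos hT z).ne'
  have hζ1 : ζ ≠ 0 := norm_ne_zero_iff.mp (by rw [norm_eq_one_of_mem_directions hT hζ]; simp)
  refine tendsto_nhdsWithin_iff.mpr ⟨?_, ?_⟩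
  · have h1 : ContinuousAt (fun x : ℝ => Φ.chart.symm (ζ * x)) 0 := by
      have h2 : ContinuousAt Φ.chart.symm (ζ * ((0 : ℝ) : ℂ)) := by
        refine Φ.chart.continuousAt_symm ?_
        simp [Φ.target_eq, Φ.radius_pos]
      exact ContinuousAt.comp (f := fun x : ℝ => ζ * (x : ℂ)) h2 (by fun_prop)
    have h2 := h1.tendsto
    simp only [Complex.ofReal_zero, mul_zero, Φ.symm_zero] at h2
    exact h2.mono_left nhdsWithin_le_nhds
  · have hmt := nhdsWithin_le_nhds (s := Ioi (0 : ℝ)) (Φ.eventually_mem_target ζ)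
    have hpos : ∀ᶠ x : ℝ in 𝓝[>] 0, 0 < x := eventually_mem_nhdsWithin
    have hsmall {δ : ℝ} (hδ : 0 < δ) : ∀ᶠ x : ℝ in 𝓝[>] 0, x ^ valueMultiplicity T z < δ := by
      have hc : ContinuousAt (fun x : ℝ => x ^ valueMultiplicity T z) 0 := by fun_prop
      refine nhdsWithin_le_nhds (hc.eventually_lt_const ?_)
      simpa [hm] using hδ
    have hev {x : ℝ} (hx : ζ * x ∈ Φ.chart.target) : T.eval (Φ.chart.symm (ζ * x)) =
        t + ζ ^ valueMultiplicity T z * x ^ valueMultiplicity T z := by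
      rw [Φ.eval_eq _ (Φ.chart.map_target hx), Φ.chart.right_inv hx, mul_pow, htz]
    have hne {x : ℝ} (hx : ζ * x ∈ Φ.chart.target) (hx0 : 0 < x) :
        Φ.chart.symm (ζ * x) ∉ ({z} : Set ℂ) := by
      intro h
      rw [mem_singleton_iff] at h
      have h2 := Φ.chart.right_inv hx
      rw [h, Φ.map_center] at h2
      exact mul_ne_zero hζ1 (Complex.ofReal_ne_zero.mpr hx0.ne') h2.symm
    rw [directions, mem_ofPred_eq, hre] at hζ
    rcases hζ with ⟨h1, h2⟩ | ⟨h1, h2⟩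
    · filter_upwards [hmt, hpos, hsmall (sub_pos.mpr h2)] with x hx hx0 hxs
      have hxp := pow_pos hx0 (valueMultiplicity T z)
      refine ⟨⟨t + x ^ valueMultiplicity T z, ⟨by linarith [ht.1], by linarith⟩, ?_⟩, hne hx hx0⟩
      rw [hev hx, h1]
      push_cast
      ring
    · filter_upwards [hmt, hpos, hsmall (by linarith : 0 < t + 1)] with x hx hx0 hxs
      have hxp := pow_pos hx0 (valueMultiplicity T z)
      refine ⟨⟨t - x ^ valueMultiplicity T z, ⟨by linarith, by linarith [ht.2]⟩, ?_⟩, hne hx hx0⟩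
      rw [hev hx, h1]
      push_cast
      ring

/-- Directions have modulus 1, so the modulus of a chart coordinate recovers the parameter, and then
the direction. -/
lemma disjoint_rayGerm (hT : 0 < T.natDegree) {ζ ξ : ℂ} (hζ : ζ ∈ directions T z)
    (hξ : ξ ∈ directions T z) (hne : ζ ≠ ξ) : Disjoint (Φ.rayGerm ζ) (Φ.rayGerm ξ) := by
  have hmem (ζ : ℂ) : {x : ℝ | 0 < x ∧ ζ * x ∈ Φ.chart.target} ∈ 𝓝[>] (0 : ℝ) :=
    inter_mem self_mem_nhdsWithin (nhdsWithin_le_nhds (Φ.eventually_mem_target ζ))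
  refine Filter.disjoint_iff.mpr ⟨_, image_mem_map (hmem ζ), _, image_mem_map (hmem ξ), ?_⟩
  rw [Set.disjoint_left]
  rintro _ ⟨x, ⟨hx0, hx⟩, rfl⟩ ⟨y, ⟨hy0, hy⟩, hxy⟩
  have h1 := Φ.chart.symm.injOn hy hx hxy
  have h2 := congrArg norm h1
  simp only [norm_mul, norm_eq_one_of_mem_directions hT hζ, norm_eq_one_of_mem_directions hT hξ,
    one_mul, Complex.norm_real, Real.norm_eq_abs, abs_of_pos hx0, abs_of_pos hy0] at h2
  rw [h2] at h1
  exact hne (mul_right_cancel₀ (Complex.ofReal_ne_zero.mpr hx0.ne') h1).symm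

/-- The germ of a curve leaving `z` inside the inverse image is the germ of a ray. -/
lemma exists_map_eq_rayGerm (hT : 0 < T.natDegree) {f : ℝ → ℂ} {s b : ℝ} (hsb : s < b)
    (hf : ContinuousOn f (Icc s b)) (hi : InjOn f (Icc s b)) (hfs : f s = z)
    (hS : ∀ t ∈ Icc s b, f t ∈ inverseImage T) :
    ∃ ζ ∈ directions T z, map f (𝓝[>] s) = Φ.rayGerm ζ := by
  have hm := (valueMultiplicity_pos hT z).ne'
  have hne : ∀ t ∈ Ioc s b, f t ≠ z := fun t ht h =>
    ht.1.ne' (hi (Ioc_subset_Icc_self ht) (left_mem_Icc.mpr hsb.le) (h.trans hfs.symm))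
  obtain ⟨η, hη, hb, ζ, hζ, H⟩ := Φ.exists_ray hT hsb hf hfs hne fun t ht => by
    obtain ⟨r, -, h⟩ := hS t ht
    exact ⟨r, h⟩
  have hsub : Icc s (s + η) ⊆ Icc s b := Icc_subset_Icc_right hb
  set x : ℝ → ℝ := fun t => ‖Φ.chart (f t)‖ with hx
  have hxc : ContinuousOn x (Icc s (s + η)) :=
    (Φ.chart.continuousOn.comp (hf.mono hsub) fun t ht => (H t ht).1).norm
  have hx0 : x s = 0 := by simp [hx, hfs, Φ.map_center]
  have hxpos : ∀ t ∈ Ioc s (s + η), 0 < x t := fun t ht => norm_pos_iff.mpr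
    (Φ.chart_ne_zero (H t (Ioc_subset_Icc_self ht)).1 (hne t ⟨ht.1, ht.2.trans hb⟩))
  refine ⟨ζ, ?_, ?_⟩
  · have hend : s + η ∈ Ioc s (s + η) := ⟨by linarith, le_rfl⟩
    obtain ⟨t, ht, htz⟩ := hfs ▸ hS s (left_mem_Icc.mpr hsb.le)
    obtain ⟨r, hr, hrz⟩ := hS _ (hsub (Ioc_subset_Icc_self hend))
    have h1 := Φ.eval_eq _ (H _ (Ioc_subset_Icc_self hend)).1
    rw [(H _ (Ioc_subset_Icc_self hend)).2, mul_pow, hrz, htz] at h1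
    have hxp := pow_pos (hxpos _ hend) (valueMultiplicity T z)
    have hre : (T.eval z).re = t := by simp [htz]
    rw [directions, mem_ofPred_eq, hre]
    rcases hζ with hζ | hζ
    · refine Or.inl ⟨hζ, ?_⟩
      rw [hζ, one_mul] at h1
      have h2 : r = t + x (s + η) ^ valueMultiplicity T z := by exact_mod_cast h1
      linarith [hr.2]
    · refine Or.inr ⟨hζ, ?_⟩
      rw [hζ, neg_one_mul] at h1
      have h2 : r = t + -x (s + η) ^ valueMultiplicity T z := by exact_mod_cast h1
      linarith [hr.1]
  · have hmapx : map x (𝓝[>] s) = 𝓝[>] 0 := by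
      refine le_antisymm ?_ ?_
      · refine tendsto_nhdsWithin_iff.mpr ⟨?_, ?_⟩
        · have h1 := (hxc s (left_mem_Icc.mpr (by linarith))).tendsto
          rw [hx0, nhdsWithin_Icc_eq_nhdsGE (by linarith)] at h1
          exact h1.mono_left (nhdsWithin_mono _ Ioi_subset_Ici_self)
        · filter_upwards [Ioc_mem_nhdsGT (by linarith : s < s + η)] with t ht using hxpos t ht
      -- The modulus is not shown to be monotone; the intermediate value theorem suffices for it to
      -- cover a right neighbourhood of 0.
      · intro A hA
        have hA' : x ⁻¹' A ∩ Ioc s (s + η) ∈ 𝓝[>] s :=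
          inter_mem hA (Ioc_mem_nhdsGT (by linarith))
        obtain ⟨u, hu, huA⟩ := mem_nhdsGT_iff_exists_Ioc_subset.mp hA'
        have hu' := huA ⟨hu, le_rfl⟩
        refine mem_of_superset (Ioc_mem_nhdsGT (hxpos u hu'.2)) fun y hy => ?_
        obtain ⟨v, hv, rfl⟩ := intermediate_value_Icc (le_of_lt hu)
          (hxc.mono (Icc_subset_Icc_right hu'.2.2)) ⟨hx0 ▸ hy.1.le, hy.2⟩
        have hv0 : v ≠ s := by
          rintro rfl
          exact hy.1.ne' hx0
        exact (huA ⟨lt_of_le_of_ne hv.1 hv0.symm, hv.2⟩).1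
    rw [rayGerm, ← hmapx, map_map]
    refine Filter.map_congr ?_
    filter_upwards [Ioc_mem_nhdsGT (by linarith : s < s + η)] with t ht
    have h1 := H t (Ioc_subset_Icc_self ht)
    simp only [Function.comp_apply, hx]
    rw [← h1.2, Φ.chart.left_inv h1.1]

lemma exists_map_eq_rayGerm_left (hT : 0 < T.natDegree) {f : ℝ → ℂ} {a s : ℝ} (has : a < s)
    (hf : ContinuousOn f (Icc a s)) (hi : InjOn f (Icc a s)) (hfs : f s = z)
    (hS : ∀ t ∈ Icc a s, f t ∈ inverseImage T) :
    ∃ ζ ∈ directions T z, map f (𝓝[<] s) = Φ.rayGerm ζ := by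
  have hm : MapsTo (fun t : ℝ => -t) (Icc (-s) (-a)) (Icc a s) := fun t ht =>
    ⟨by linarith [ht.2], by linarith [ht.1]⟩
  obtain ⟨ζ, hζ, h⟩ := Φ.exists_map_eq_rayGerm hT (f := f ∘ fun t => -t) (neg_lt_neg has)
    (hf.comp continuousOn_neg hm) (hi.comp neg_injective.injOn hm) (by simpa using hfs)
    (fun t ht => hS _ (hm ht))
  refine ⟨ζ, hζ, ?_⟩
  rw [← h, ← map_map]
  congr 1
  have := (Homeomorph.neg ℝ).isEmbedding.map_nhdsWithin_eq (Ioi (-s)) (-s)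
  simp only [Homeomorph.coe_neg, neg_neg, image_neg_eq_neg, Set.neg_Ioi] at this
  exact this.symm

end PowerChart

/-! ### Matching branches with the arcs of a decomposition. -/

/-- Near one of its points, an arc is the union of the two germs of curves issuing from it. -/
lemma nhdsWithin_arc_le {F : ℝ → ℂ} (hF : Continuous F) (hi : InjOn F (Icc 0 1)) {s : ℝ}
    (hs : s ∈ Icc (0 : ℝ) 1) :
    𝓝[F '' Icc 0 1 \ {F s}] (F s) ≤ map F (𝓝[Ico 0 s] s) ⊔ map F (𝓝[Ioc s 1] s) := by
  rw [← Filter.map_sup, ← nhdsWithin_union]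
  intro U hU
  obtain ⟨O, hO, hsO, hOU⟩ := mem_nhdsWithin.mp hU
  have hc : IsClosed (F '' (Icc 0 1 \ O)) := ((isCompact_Icc.diff hO).image hF).isClosed
  refine mem_nhdsWithin.mpr ⟨(F '' (Icc 0 1 \ O))ᶜ, hc.isOpen_compl, ?_, ?_⟩
  · rintro ⟨t, ht, hts⟩
    exact ht.2 (hi ht.1 hs hts ▸ hsO)
  · rintro _ ⟨hw, ⟨t, ht, rfl⟩, hts⟩
    have htO : t ∈ O := by
      by_contra h
      exact hw ⟨t, ⟨ht, h⟩, rfl⟩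
    refine hOU ⟨htO, ?_⟩
    rcases lt_trichotomy t s with h | h | h
    · exact Or.inl ⟨ht.1, h⟩
    · exact absurd (congrArg F h) hts
    · exact Or.inr ⟨h, ht.2⟩

/-- The branches of the inverse image at one of its points are matched in pairs by the arcs of a
decomposition, up to those on which an arc ends. -/
lemma even_ncard_directions_add_card_endpoints {T : ℂ[X]} (hT : 0 < T.natDegree) {k : ℕ}
    {a : Fin (2 * k) → ℂ} (h : ConsistsOfJordanArcs (inverseImage T) k a) {z : ℂ}
    (hz : z ∈ inverseImage T) :
    Even ((directions T z).ncard + (Finset.univ.filter fun i => a i = z).card) := by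
  classical
  obtain ⟨K, e, h1, h2, h3⟩ := h
  obtain ⟨Φ, -⟩ := exists_powerChart hT z univ_mem
  have hsub (j) : K j ⊆ inverseImage T := h2 ▸ subset_iUnion K j
  choose F hF hFi hF0 hF1 hFK using fun j => (h1 j).exists_param
  have hex (j) : ∃ s ∈ Icc (0 : ℝ) 1, z ∈ K j → F j s = z := by
    by_cases hzj : z ∈ K j
    · obtain ⟨s, hs, h⟩ := hFK j ▸ hzj
      exact ⟨s, hs, fun _ => h⟩
    -- A default parameter for the arcs that miss `z`.
    · exact ⟨0, ⟨le_rfl, zero_le_one⟩, fun h => absurd h hzj⟩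
  choose s hs hFs using hex
  have hFS (j) {t : ℝ} (ht : t ∈ Icc (0 : ℝ) 1) : F j t ∈ inverseImage T :=
    hsub j (hFK j ▸ mem_image_of_mem _ ht)
  let idx : Fin k ⊕ Fin k → Fin k := Sum.elim id id
  -- `L` lists the backward and forward germs of each arc at its parameter `s j`. `G` selects the
  -- sides that matter: the arc passes through `z` and does not end there on that side. On a side
  -- where it does end at `z`, the parameter set is empty and the germ is `⊥`.
  let L : Fin k ⊕ Fin k → Filter ℂ := Sum.elim
    (fun j => map (F j) (𝓝[Ico 0 (s j)] (s j))) (fun j => map (F j) (𝓝[Ioc (s j) 1] (s j)))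
  let G : Finset (Fin k ⊕ Fin k) := Finset.univ.filter fun x => z ∈ K (idx x) ∧ a (e x) ≠ z
  have hray : ∀ x ∈ G, ∃ ζ ∈ directions T z, L x = Φ.rayGerm ζ := by
    intro x hx
    obtain ⟨hzx, hax⟩ := (Finset.mem_filter.mp hx).2
    rcases x with j | j
    · have hzj : z ∈ K j := hzx
      have h0 : 0 < s j := lt_of_le_of_ne (hs j).1 fun h => hax (by rw [← hF0, h, hFs j hzj])
      simp only [L, Sum.elim_inl, nhdsWithin_Ico_eq_nhdsLT h0]
      have hI : Icc 0 (s j) ⊆ Icc (0 : ℝ) 1 := Icc_subset_Icc_right (hs j).2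
      exact Φ.exists_map_eq_rayGerm_left hT h0 (hF j).continuousOn ((hFi j).mono hI) (hFs j hzj)
        fun t ht => hFS j (hI ht)
    · have hzj : z ∈ K j := hzx
      have h0 : s j < 1 := lt_of_le_of_ne (hs j).2 fun h => hax (by rw [← hF1, ← h, hFs j hzj])
      simp only [L, Sum.elim_inr, nhdsWithin_Ioc_eq_nhdsGT h0]
      have hI : Icc (s j) 1 ⊆ Icc (0 : ℝ) 1 := Icc_subset_Icc_left (hs j).1
      exact Φ.exists_map_eq_rayGerm hT h0 (hF j).continuousOn ((hFi j).mono hI) (hFs j hzj)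
        fun t ht => hFS j (hI ht)
  choose! ζ hζ hLζ using hray
  have hLle : ∀ x, z ∈ K (idx x) → L x ≤ 𝓝[K (idx x) \ {z}] z := by
    intro x hx
    have haux (j : Fin k) (hj : z ∈ K j) (A : Set ℝ) (hA : A ⊆ Icc 0 1) (hA' : s j ∉ A) :
        map (F j) (𝓝[A] (s j)) ≤ 𝓝[K j \ {z}] z := by
      refine tendsto_nhdsWithin_iff.mpr ⟨?_, ?_⟩
      · have := (hF j).continuousAt.tendsto (x := s j)
        rw [hFs j hj] at this
        exact this.mono_left nhdsWithin_le_nhds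
      · filter_upwards [self_mem_nhdsWithin] with t ht
        refine ⟨hFK j ▸ mem_image_of_mem _ (hA ht), fun h => hA' ?_⟩
        have h' : F j t = F j (s j) := h.trans (hFs j hj).symm
        exact hFi j (hA ht) (hs j) h' ▸ ht
    rcases x with j | j
    · exact haux j hx _ (fun t ht => ⟨ht.1, ht.2.le.trans (hs j).2⟩) fun h => lt_irrefl _ h.2
    · exact haux j hx _ (fun t ht => ⟨(hs j).1.trans ht.1.le, ht.2⟩) fun h => lt_irrefl _ h.1
  have hLdisj : ∀ x y, z ∈ K (idx x) → z ∈ K (idx y) → x ≠ y → Disjoint (L x) (L y) := by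
    have hside (j : Fin k) : Disjoint (L (Sum.inl j)) (L (Sum.inr j)) := by
      refine Filter.disjoint_iff.mpr ⟨_, image_mem_map self_mem_nhdsWithin, _,
        image_mem_map self_mem_nhdsWithin, ?_⟩
      rw [Set.disjoint_left]
      rintro _ ⟨t, ht, rfl⟩ ⟨u, hu, hut⟩
      have := hFi j ⟨(hs j).1.trans hu.1.le, hu.2⟩ ⟨ht.1, ht.2.le.trans (hs j).2⟩ hut
      exact lt_asymm ht.2 (this ▸ hu.1)
    intro x y hx hy hxy
    by_cases hj : idx x = idx y
    · rcases x with x | x <;> rcases y with y | y <;> simp only [idx, Sum.elim_inl, Sum.elim_inr,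
        id] at hj <;> subst hj
      · exact absurd rfl hxy
      · exact hside x
      · exact (hside x).symm
      · exact absurd rfl hxy
    · refine Disjoint.mono (hLle x hx) (hLle y hy) ?_
      rw [disjoint_iff, ← nhdsWithin_inter, ← notMem_closure_iff_nhdsWithin_eq_bot]
      have hf : (K (idx x) \ {z} ∩ (K (idx y) \ {z})).Finite :=
        (h3 hj).subset (inter_subset_inter sdiff_subset sdiff_subset)
      rw [hf.isClosed.closure_eq]
      exact fun h => h.1.2 rfl
  have hinj : InjOn ζ G := by
    intro x hx y hy hxy
    by_contra hne
    have hd := hLdisj x y (Finset.mem_filter.mp hx).2.1 (Finset.mem_filter.mp hy).2.1 hne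
    rw [hLζ x hx, hLζ y hy, hxy, disjoint_self] at hd
    exact (inferInstance : (Φ.rayGerm (ζ y)).NeBot).ne hd
  -- Near `z` the inverse image consists only of the selected germs, so no direction can be missed:
  -- its germ would be disjoint from a filter that contains it, yet is nontrivial.
  have hsup : 𝓝[inverseImage T \ {z}] z ≤ G.sup L := by
    rw [← h2, iUnion_sdiff, nhdsWithin_iUnion]
    refine iSup_le fun j => ?_
    by_cases hzj : z ∈ K j
    · have h4 := nhdsWithin_arc_le (hF j) (hFi j) (hs j)
      rw [hFK, hFs j hzj] at h4
      refine h4.trans (sup_le ?_ ?_)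
      · by_cases haj : a (e (Sum.inl j)) = z
        · have : s j = 0 := hFi j (hs j) ⟨le_rfl, zero_le_one⟩ (by rw [hFs j hzj, hF0, haj])
          simp [this]
        · exact Finset.le_sup (f := L) (b := Sum.inl j)
            (Finset.mem_filter.mpr ⟨Finset.mem_univ _, hzj, haj⟩)
      · by_cases haj : a (e (Sum.inr j)) = z
        · have : s j = 1 := hFi j (hs j) ⟨zero_le_one, le_rfl⟩ (by rw [hFs j hzj, hF1, haj])
          simp [this]
        · exact Finset.le_sup (f := L) (b := Sum.inr j)
            (Finset.mem_filter.mpr ⟨Finset.mem_univ _, hzj, haj⟩)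
    · have : 𝓝[K j \ {z}] z = ⊥ := by
        rw [← notMem_closure_iff_nhdsWithin_eq_bot]
        exact fun h => hzj ((h1 j).isCompact.isClosed.closure_subset
          (closure_mono sdiff_subset h))
      rw [this]
      exact bot_le
  have himage : directions T z = ζ '' G := by
    refine Subset.antisymm (fun ξ hξ => ?_) ?_
    · by_contra hξG
      have hle := (Φ.rayGerm_le hT hz hξ).trans hsup
      have hd : Disjoint (Φ.rayGerm ξ) (G.sup L) := by
        rw [Finset.disjoint_sup_right]
        intro x hx
        rw [hLζ x hx]
        exact Φ.disjoint_rayGerm hT hξ (hζ x hx) fun h => hξG ⟨x, hx, h.symm⟩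
      exact (inferInstance : (Φ.rayGerm ξ).NeBot).ne (hd.eq_bot_of_le hle)
    · rintro _ ⟨x, hx, rfl⟩
      exact hζ x hx
  have hcard : (directions T z).ncard = G.card := by
    rw [himage, hinj.ncard_image, ncard_coe_finset]
  have hends : (Finset.univ.filter fun i => a i = z).card =
      (Finset.univ.filter fun x => a (e x) = z).card := by
    rw [Finset.card_filter, Finset.card_filter]
    exact (Equiv.sum_comp e fun i => if a i = z then 1 else 0).symm
  have hend_mem (x) (hx : a (e x) = z) : z ∈ K (idx x) := by
    rcases x with j | j
    · exact hx ▸ (h1 j).left_mem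
    · exact hx ▸ (h1 j).right_mem
  have hsum : G.card + (Finset.univ.filter fun x => a (e x) = z).card =
      (Finset.univ.filter fun x => z ∈ K (idx x)).card := by
    rw [← Finset.card_union_of_disjoint]
    · congr 1
      ext x
      simp only [G, Finset.mem_union, Finset.mem_filter, Finset.mem_univ, true_and]
      have := hend_mem x
      tauto
    · rw [Finset.disjoint_left]
      intro x hx hx'
      exact (Finset.mem_filter.mp hx).2.2 (Finset.mem_filter.mp hx').2
  -- Branches and endpoints at `z` together account for both sides of every arc through `z`, which
  -- is twice the number of these arcs.
  rw [hcard, hends, hsum, Finset.card_filter, Fintype.sum_sum_type]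
  exact ⟨_, rfl⟩

/-- The zeros of odd multiplicity of `T ^ 2 - 1` are the points that occur an odd number of times
as endpoints in a decomposition of the inverse image into arcs. -/
lemma odd_card_endpoints_iff {T : ℂ[X]} (hT : 0 < T.natDegree) {k : ℕ} {a : Fin (2 * k) → ℂ}
    (h : ConsistsOfJordanArcs (inverseImage T) k a) (z : ℂ) :
    Odd (Finset.univ.filter fun i => a i = z).card ↔ Odd ((T ^ 2 - 1).rootMultiplicity z) := by
  by_cases hz : z ∈ inverseImage T
  · rw [← odd_ncard_directions hT hz]
    have := even_ncard_directions_add_card_endpoints hT h hz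
    grind
  · have h1 : (Finset.univ.filter fun i => a i = z) = ∅ := by
      rw [Finset.filter_eq_empty_iff]
      rintro i - hi
      refine hz ?_
      obtain ⟨K, e, h1, h2, -⟩ := h
      rw [← h2, ← hi, ← e.apply_symm_apply i]
      rcases e.symm i with j | j
      exacts [mem_iUnion_of_mem j (h1 j).left_mem, mem_iUnion_of_mem j (h1 j).right_mem]
    have h2 : T.eval z ≠ 1 := fun h => hz ⟨1, by norm_num, by simp [h]⟩
    have h3 : T.eval z ≠ -1 := fun h => hz ⟨-1, by norm_num, by simp [h]⟩
    rw [h1, rootMultiplicity_sq_sub_one hT, rootMultiplicity_sub_C_eq_zero h2,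
      rootMultiplicity_sub_C_eq_zero h3]
    simp

/-! ### Minimal decompositions and zeros of odd multiplicity. -/

lemma natDegree_sq_sub_one (T : ℂ[X]) :
    (T ^ 2 - 1).natDegree = 2 * T.natDegree := by
  rw [show (1 : ℂ[X]) = C 1 from C_1.symm, natDegree_sub_C, natDegree_pow]

lemma leadingCoeff_sq_sub_one {T : ℂ[X]} (hT : 0 < T.natDegree) :
    (T ^ 2 - 1).leadingCoeff = T.leadingCoeff ^ 2 := by
  rw [leadingCoeff_sub_of_degree_lt, leadingCoeff_pow]
  refine degree_lt_degree ?_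
  rw [natDegree_one, natDegree_pow]
  omega

lemma odd_rootMultiplicity_subset_range {T : ℂ[X]} (hT : 0 < T.natDegree) {k : ℕ}
    {a : Fin (2 * k) → ℂ} (h : ConsistsOfJordanArcs (inverseImage T) k a) :
    {z : ℂ | Odd ((T ^ 2 - 1).rootMultiplicity z)} ⊆ range a := by
  intro z hz
  rw [mem_ofPred_eq, ← odd_card_endpoints_iff hT h z] at hz
  obtain ⟨i, hi⟩ := Finset.card_pos.mp hz.pos
  exact ⟨i, (Finset.mem_filter.mp hi).2⟩

lemma odd_rootMultiplicity_eq_range {T : ℂ[X]} (hT : 0 < T.natDegree) {k : ℕ}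
    {a : Fin (2 * k) → ℂ} (h : ConsistsOfJordanArcs (inverseImage T) k a)
    (ha : Function.Injective a) :
    {z : ℂ | Odd ((T ^ 2 - 1).rootMultiplicity z)} = range a := by
  refine Subset.antisymm (odd_rootMultiplicity_subset_range hT h) ?_
  rintro _ ⟨i, rfl⟩
  rw [mem_ofPred_eq, ← odd_card_endpoints_iff hT h]
  have h1 : (Finset.univ.filter fun j => a j = a i) = {i} := by
    ext j
    simp [ha.eq_iff]
  rw [h1, Finset.card_singleton]
  exact odd_one

lemma exists_minimal_decomposition {T : ℂ[X]} (hT : 0 < T.natDegree) :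
    ∃ (k : ℕ) (b : Fin (2 * k) → ℂ), ConsistsOfJordanArcs (inverseImage T) k b ∧
      ∀ k' < k, ∀ b' : Fin (2 * k') → ℂ, ¬ ConsistsOfJordanArcs (inverseImage T) k' b' := by
  classical
  have hex : ∃ k, ∃ b, ConsistsOfJordanArcs (inverseImage T) k b := by
    obtain ⟨ι, _, K, p, q, h1, h2, h3⟩ := isFiniteArcUnion_inverseImage hT
    exact ⟨_, exists_consistsOfJordanArcs h1 h2 h3⟩
  obtain ⟨b, hb⟩ := Nat.find_spec hex
  exact ⟨_, b, hb, fun k' hk' b' hb' => Nat.find_min hex hk' ⟨b', hb'⟩⟩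

lemma ConsistsOfJordanArcs.reindex {S : Set ℂ} {k : ℕ} {b : Fin (2 * k) → ℂ}
    (h : ConsistsOfJordanArcs S k b) (π : Equiv.Perm (Fin (2 * k))) :
    ConsistsOfJordanArcs S k (b ∘ π) := by
  obtain ⟨K, e, h1, h2, h3⟩ := h
  exact ⟨K, e.trans π.symm, fun j => by simpa using h1 j, h2, h3⟩

lemma exists_perm_of_range_eq {α : Type*} {m : ℕ} {a b : Fin m → α} (ha : Function.Injective a)
    (hb : Function.Injective b) (h : range a = range b) : ∃ π : Equiv.Perm (Fin m), b ∘ π = a := by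
  refine ⟨(Equiv.ofInjective a ha).trans ((Equiv.setCongr h).trans (Equiv.ofInjective b hb).symm),
    funext fun i => ?_⟩
  exact congrArg Subtype.val ((Equiv.ofInjective b hb).apply_symm_apply _)

lemma ncard_range_fin {α : Type*} {m : ℕ} {a : Fin m → α} (ha : Function.Injective a) :
    (range a).ncard = m := by
  rw [← Nat.card_coe_set_eq, Nat.card_range_of_injective ha, Nat.card_fin]

/-- For the converse, a minimal decomposition exists and its distinct endpoints are the zeros of odd
multiplicity. It therefore has `l` arcs, and `a` is a permutation of its list of endpoints. Forward,
`1 ≤ l` holds because a zero of `T` lies in the inverse image, and `l ≤ T.natDegree` because `T ^ 2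
- 1` has degree `2 * T.natDegree`. -/
lemma minimal_decomposition_iff {T : ℂ[X]} (hT : 0 < T.natDegree) (l : ℕ) (a : Fin (2 * l) → ℂ) :
    (ConsistsOfJordanArcs (inverseImage T) l a ∧
        ∀ k < l, ∀ b : Fin (2 * k) → ℂ, ¬ ConsistsOfJordanArcs (inverseImage T) k b) ↔
      (1 ≤ l ∧ l ≤ T.natDegree ∧ Function.Injective a ∧
        {z : ℂ | Odd ((T ^ 2 - 1).rootMultiplicity z)} = range a) := by
  constructor
  · rintro ⟨h, hmin⟩
    have ha := endpoints_injective_of_minimal hT h hmin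
    have hr := odd_rootMultiplicity_eq_range hT h ha
    refine ⟨?_, ?_, ha, hr⟩
    · by_contra hl
      obtain rfl : l = 0 := by omega
      obtain ⟨z, hz⟩ := IsAlgClosed.exists_root T (natDegree_pos_iff_degree_pos.mp hT).ne'
      have hzS : z ∈ inverseImage T := ⟨0, by norm_num, by simpa using hz⟩
      obtain ⟨K, -, -, h2, -⟩ := h
      rw [← h2] at hzS
      obtain ⟨j, -⟩ := mem_iUnion.mp hzS
      exact j.elim0
    · have hsub : range a ⊆ ((T ^ 2 - 1).roots.toFinset : Set ℂ) := by
        rw [← hr]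
        intro z hz
        have h0 := Odd.pos hz
        rw [Finset.mem_coe, Multiset.mem_toFinset]
        rwa [← count_roots, Multiset.count_pos] at h0
      have h1 := ncard_le_ncard hsub (Finset.finite_toSet _)
      rw [ncard_range_fin ha, ncard_coe_finset] at h1
      have h2 := (Multiset.toFinset_card_le _).trans (card_roots' (T ^ 2 - 1))
      rw [natDegree_sq_sub_one T] at h2
      omega
  · rintro ⟨-, -, ha, hr⟩
    obtain ⟨k, b, hb, hmin⟩ := exists_minimal_decomposition hT
    have hbi := endpoints_injective_of_minimal hT hb hmin
    have hbr := odd_rootMultiplicity_eq_range hT hb hbi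
    have hab := hr.symm.trans hbr
    have hkl : 2 * l = 2 * k := by rw [← ncard_range_fin ha, ← ncard_range_fin hbi, hab]
    obtain rfl : l = k := by omega
    obtain ⟨π, rfl⟩ := exists_perm_of_range_eq ha hbi hab
    exact ⟨hb.reindex π, hmin⟩

/-! ### Splitting off the square factor. -/

lemma rootMultiplicity_prod_X_sub_C {m : ℕ} {a : Fin m → ℂ} (ha : Function.Injective a) (z : ℂ)
    [Decidable (z ∈ range a)] :
    (∏ j, (X - C (a j))).rootMultiplicity z = if z ∈ range a then 1 else 0 := by
  classical
  have h1 : (∏ j, (X - C (a j))).roots = Finset.univ.val.map a := by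
    rw [← roots_multiset_prod_X_sub_C (Finset.univ.val.map a), Multiset.map_map]
    rfl
  have h2 : (Finset.univ.val.map a).Nodup := Finset.univ.nodup.map ha
  rw [← count_roots, h1, Multiset.count_eq_of_nodup h2]
  simp

/-- A polynomial is a constant times the product over its zeros of odd multiplicity times the
square of a monic polynomial. -/
lemma exists_eq_prod_mul_sq (P : ℂ[X]) {m : ℕ} {a : Fin m → ℂ} (ha : Function.Injective a)
    (h : {z : ℂ | Odd (P.rootMultiplicity z)} = range a) :
    ∃ V : ℂ[X], V.Monic ∧ P = C P.leadingCoeff * ((∏ j, (X - C (a j))) * V ^ 2) := by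
  classical
  -- Each multiplicity `μ` is written as `μ % 2 + 2 * (μ / 2)`; the remainders make up the product
  -- over the `a j`.
  refine ⟨∏ z ∈ P.roots.toFinset, (X - C z) ^ (P.rootMultiplicity z / 2),
    monic_prod_of_monic _ _ fun z _ => (monic_X_sub_C z).pow _, ?_⟩
  have h1 : ∏ j, (X - C (a j)) =
      ∏ z ∈ P.roots.toFinset, (X - C z) ^ (P.rootMultiplicity z % 2) := by
    have h2 : ∏ j, (X - C (a j)) = ∏ z ∈ Finset.univ.image a, (X - C z) :=
      (Finset.prod_image (f := fun z => X - C z) ha.injOn).symm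
    have hmem (z : ℂ) : z ∈ Finset.univ.image a ↔ Odd (P.rootMultiplicity z) := by
      have : z ∈ range a ↔ Odd (P.rootMultiplicity z) := by rw [← h]; rfl
      simpa using this
    rw [h2]
    have h3 : Finset.univ.image a ⊆ P.roots.toFinset := by
      intro z hz
      have h0 := ((hmem z).mp hz).pos
      rw [Multiset.mem_toFinset]
      rwa [← count_roots, Multiset.count_pos] at h0
    rw [← Finset.prod_subset h3]
    · refine Finset.prod_congr rfl fun z hz => ?_
      rw [Nat.odd_iff.mp ((hmem z).mp hz), pow_one]
    · intro z _ hz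
      rw [hmem, Nat.not_odd_iff] at hz
      rw [hz, pow_zero]
  rw [h1, ← Finset.prod_pow, ← Finset.prod_mul_distrib]
  conv_lhs => rw [(IsAlgClosed.splits P).eq_prod_roots, prod_multiset_root_eq_finset_root]
  congr 1
  refine Finset.prod_congr rfl fun z _ => ?_
  rw [← pow_mul, ← pow_add]
  congr 1
  omega

/-- The leading coefficient of `T ^ 2 - 1` is the square of that of `T`, so it is absorbed into the
square by scaling the monic root. Conversely, `U ^ 2` contributes an even multiplicity everywhere,
so parity is decided by the simple zeros `a j`. -/
lemma odd_rootMultiplicity_iff_factorization {T : ℂ[X]} (hT : 0 < T.natDegree) {l : ℕ}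
    {a : Fin (2 * l) → ℂ} (ha : Function.Injective a) (hl : l ≤ T.natDegree) :
    {z : ℂ | Odd ((T ^ 2 - 1).rootMultiplicity z)} = range a ↔
      ∃ U : ℂ[X], U.natDegree = T.natDegree - l ∧ U.leadingCoeff = T.leadingCoeff ∧
        T ^ 2 - 1 = (∏ j, (X - C (a j))) * U ^ 2 := by
  classical
  have hP0 : T ^ 2 - 1 ≠ 0 := by
    intro h
    have := natDegree_sq_sub_one T
    rw [h, natDegree_zero] at this
    omega
  constructor
  · intro h
    obtain ⟨V, hV, hPV⟩ := exists_eq_prod_mul_sq _ ha h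
    have hlc : T.leadingCoeff ≠ 0 := leadingCoeff_ne_zero.mpr (ne_zero_of_natDegree_gt hT)
    have hfac : T ^ 2 - 1 = (∏ j, (X - C (a j))) * (C T.leadingCoeff * V) ^ 2 := by
      rw [hPV, leadingCoeff_sq_sub_one hT, C_pow]
      ring
    refine ⟨C T.leadingCoeff * V, ?_, ?_, hfac⟩
    · have hdeg := congrArg natDegree hfac
      rw [natDegree_sq_sub_one T, (monic_prod_X_sub_C a Finset.univ).natDegree_mul',
        natDegree_pow, natDegree_prod_of_monic] at hdeg
      · simp at hdeg
        omega
      · exact fun j _ => monic_X_sub_C _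
      · exact pow_ne_zero _ (mul_ne_zero (C_ne_zero.mpr hlc) hV.ne_zero)
    · rw [leadingCoeff_mul, leadingCoeff_C, hV.leadingCoeff, mul_one]
  · rintro ⟨U, -, -, hU⟩
    ext z
    rw [mem_ofPred_eq, hU, rootMultiplicity_mul (hU ▸ hP0), rootMultiplicity_prod_X_sub_C ha,
      sq, rootMultiplicity_mul]
    · by_cases hz : z ∈ range a
      · simp only [hz, if_true, iff_true]
        exact ⟨_, by ring⟩
      · simp only [hz, if_false, iff_false, Nat.not_odd_iff_even]
        exact ⟨_, by ring⟩
    · rw [← sq]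
      exact right_ne_zero_of_mul (hU ▸ hP0)

theorem theorem2 (n : ℕ) (hn : 1 ≤ n) (T : ℂ[X]) (hT : T.natDegree = n)
    (l : ℕ) (a : Fin (2 * l) → ℂ) :
    ((ConsistsOfJordanArcs (inverseImage T) l a ∧
        ∀ k < l, ∀ b : Fin (2 * k) → ℂ, ¬ ConsistsOfJordanArcs (inverseImage T) k b) ↔
      (1 ≤ l ∧ l ≤ n ∧ Function.Injective a ∧
        {z : ℂ | Odd ((T ^ 2 - 1).rootMultiplicity z)} = Set.range a)) ∧
    ((ConsistsOfJordanArcs (inverseImage T) l a ∧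
        ∀ k < l, ∀ b : Fin (2 * k) → ℂ, ¬ ConsistsOfJordanArcs (inverseImage T) k b) ↔
      (1 ≤ l ∧ l ≤ n ∧ Function.Injective a ∧
        ∃ U : ℂ[X], U.natDegree = n - l ∧ U.leadingCoeff = T.leadingCoeff ∧
          T ^ 2 - 1 = (∏ j, (X - C (a j))) * U ^ 2)) := by
  subst hT
  refine ⟨minimal_decomposition_iff hn l a, (minimal_decomposition_iff hn l a).trans ?_⟩
  refine and_congr_right fun _ => and_congr_right fun hl => and_congr_right fun ha => ?_
  exact odd_rootMultiplicity_iff_factorization hn ha hl
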